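/- All manifolds are finite-dimensional, Hausdorff, second countable and $C^\infty$; all maps, forms and functions are $C^\infty$. Let $G$ be a connected Lie group with Lie algebra $\mathfrak g$ and let $(M,\Omega)$ be a connected presymplectic manifold, i.e. $\Omega$ is a closed $2$-form of constant rank. Let $H\in C^\infty(M)$ be such that the equation $i(X)\Omega=dH$ has a solution $X\in\mathfrak X(M)$ on all of $M$. Let $G$ act on $M$ preserving $\Omega$ and $H$, and assume that $\ker\Omega$ is tangent to the $G$-orbits: every $v\in\ker\Omega_x$ is the value at $x$ of a fundamental vector field. Let $(\mathbf M,\mathbf\Omega,\mathbf H)$ be an ambient symplectic system: $(\mathbf M,\mathbf\Omega)$ is a connected symplectic manifold, $j_0\colon M\hookrightarrow\mathbf M$ is a coisotropic embedding onto a closed submanifold, $j_0^*\mathbf\Omega=\Omega$, $\mathbf H\in C^\infty(\mathbf M)$ and $j_0^*\mathbf H=H$. Assume that the action of $G$ on $M$ extends to a free, proper, Poissonian symplectic action of $G$ on $\mathbf M$ (so that $j_0(g\cdot x)=g\cdot j_0(x)$), with momentum map $\mathbf J\colon\mathbf M\to\mathfrak g^*$; that is, with $\tilde\xi$ the fundamental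 vector fields and $\mathbf f_\xi=\langle\mathbf J,\xi\rangle$, $d\mathbf f_\xi=i(\tilde\xi)\mathbf\Omega$ and $\mathbf f_{[\xi,\eta]}=\mathbf\Omega(\tilde\xi,\tilde\eta)$. Put $\mathcal J=\mathbf J\circ j_0$. Let $\mu\in\mathfrak g^*$ be a weakly regular value of both $\mathcal J$ and $\mathbf J$ (the level set is an embedded submanifold whose tangent spaces are the kernels of the tangent map of the momentum map). Let $\Omega_\mu,H_\mu$ and $\mathbf\Omega_\mu,\mathbf H_\mu$ be the restrictions of the forms and functions to $\mathcal J^{-1}(\mu)$ and $\mathbf J^{-1}(\mu)$, and let $j_{0\mu}\colon\mathcal J^{-1}(\mu)\to\mathbf J^{-1}(\mu)$ be the map induced by $j_0$. Assume that the leaf spaces $\mathcal J^{-1}(\mu)/\ker\Omega_\mu$ and $\mathbf J^{-1}(\mu)/\ker\mathbf\Omega_\mu$ are quotient manifolds, i.e. carry smooth structures for which the projections $\pi_\mu$, $\pi'_\mu$ are submersions with $\ker T\pi_\mu=\ker\Omega_\mu$ and $\ker T\pi'_\mu=\ker\mathbf\Omega_\mu$. Then: 1. $j_{0\mu}$ is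 an injective local diffeomorphism, and $j_{0\mu}(\mathcal J^{-1}(\mu))$ is a union of connected components of $\mathbf J^{-1}(\mu)$. Moreover $j_{0\mu}^*\mathbf\Omega_\mu=\Omega_\mu$ and $j_{0\mu}^*\mathbf H_\mu=H_\mu$. 2. There are unique $2$-forms $\hat\Omega$, $\hat{\mathbf\Omega}$ on the leaf spaces with $\pi_\mu^*\hat\Omega=\Omega_\mu$ and $\pi_\mu'^*\hat{\mathbf\Omega}=\mathbf\Omega_\mu$, and a unique function $\hat H$ with $\pi_\mu^*\hat H=H_\mu$; if $\mathbf H$ is $G$-invariant, there is also a unique function $\hat{\mathbf H}$ with $\pi_\mu'^*\hat{\mathbf H}=\mathbf H_\mu$. The map $j_{0\mu}$ induces a map $\hat\jmath_0\colon\mathcal J^{-1}(\mu)/\ker\Omega_\mu\to\mathbf J^{-1}(\mu)/\ker\mathbf\Omega_\mu$ with $\hat\jmath_0\circ\pi_\mu=\pi'_\mu\circ j_{0\mu}$; it is an injective local diffeomorphism, and its image is a union of connected components of $\mathbf J^{-1}(\mu)/\ker\mathbf\Omega_\mu$. Moreover $\hat\jmath_0^*\hat{\mathbf\Omega}=\hat\Omega$,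 and $\hat\jmath_0^*\hat{\mathbf H}=\hat H$ for every function $\hat{\mathbf H}$ with $\pi_\mu'^*\hat{\mathbf H}=\mathbf H_\mu$. -/

import Mathlib

open Set
open scoped Manifold ContDiff

noncomputable section

namespace PresymplecticReduction

section Forms

variable {E F : Type*} [NormedAddCommGroup E] [NormedSpace ℝ E]
  [NormedAddCommGroup F] [NormedSpace ℝ F]
  {M N : Type*} [TopologicalSpace M] [ChartedSpace E M]
  [TopologicalSpace N] [ChartedSpace F N]

/-- A (not necessarily continuous) differential 2-form on a manifold `M` modelled on `E`: an
alternating bilinear form on every tangent space. -/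
abbrev TwoForm (E M : Type*) [NormedAddCommGroup E] [NormedSpace ℝ E]
    [TopologicalSpace M] [ChartedSpace E M] : Type _ :=
  ∀ x : M, (TangentSpace 𝓘(ℝ, E) x) [⋀^Fin 2]→L[ℝ] ℝ

/-- The pull-back `f^* σ` of a 2-form. -/
def pullback (E : Type*) [NormedAddCommGroup E] [NormedSpace ℝ E] [ChartedSpace E M]
    (f : M → N) (σ : TwoForm F N) : TwoForm E M :=
  fun x => (σ (f x)).compContinuousLinearMap (mfderiv 𝓘(ℝ, E) 𝓘(ℝ, F) f x)

/-- The coordinate expression of a 2-form in a chart `e`: its pull-back along `e⁻¹`. -/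
def inChart (σ : TwoForm E M) (e : OpenPartialHomeomorph M E) : E → E [⋀^Fin 2]→L[ℝ] ℝ :=
  fun y => (σ (e.symm y)).compContinuousLinearMap (mfderiv 𝓘(ℝ, E) 𝓘(ℝ, E) e.symm y)

/-- `σ` is `C^∞`: all its coordinate expressions are. -/
def IsSmoothForm (σ : TwoForm E M) : Prop :=
  ∀ e ∈ IsManifold.maximalAtlas 𝓘(ℝ, E) ∞ M, ContDiffOn ℝ ∞ (inChart σ e) e.target

/-- `dσ = 0`: the exterior derivative vanishes in all charts. -/
def IsClosedForm (σ : TwoForm E M) : Prop :=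
  ∀ e ∈ IsManifold.maximalAtlas 𝓘(ℝ, E) ∞ M, ∀ y ∈ e.target, extDeriv (inChart σ e) y = 0

/-- The kernel `ker σ_x` of a 2-form at the point `x`. -/
def formKer (σ : TwoForm E M) (x : M) : Submodule ℝ (TangentSpace 𝓘(ℝ, E) x) where
  carrier := {v | ∀ w, σ x ![v, w] = 0}
  add_mem' := by
    intro a b ha hb w
    have e : ∀ v, Function.update ![a, w] 0 v = ![v, w] := by
      intro v; ext i; fin_cases i <;> simp
    have h := (σ x).toAlternatingMap.map_update_add ![a, w] 0 a b
    rw [e, e, e] at h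
    exact h.trans (by rw [show (σ x).toAlternatingMap ![a, w] = 0 from ha w,
      show (σ x).toAlternatingMap ![b, w] = 0 from hb w, add_zero])
  zero_mem' := by
    intro w
    exact (σ x).toAlternatingMap.map_coord_zero 0 (by simp)
  smul_mem' := by
    intro c a ha w
    have e : ∀ v, Function.update ![a, w] 0 v = ![v, w] := by
      intro v; ext i; fin_cases i <;> simp
    have h := (σ x).toAlternatingMap.map_update_smul ![a, w] 0 c a
    rw [e, e] at h
    exact h.trans (by rw [show (σ x).toAlternatingMap ![a, w] = 0 from ha w, smul_zero])

/-- A presymplectic form: a smooth closed 2-form of constant rank. -/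
structure IsPresymplectic (σ : TwoForm E M) : Prop where
  smooth : IsSmoothForm σ
  closed : IsClosedForm σ
  constant_rank : ∃ r : ℕ, ∀ x, Module.finrank ℝ (formKer σ x) = r

/-- A symplectic form: a smooth closed nondegenerate 2-form. -/
structure IsSymplectic (σ : TwoForm E M) : Prop where
  smooth : IsSmoothForm σ
  closed : IsClosedForm σ
  nondegenerate : ∀ x, formKer σ x = ⊥

/-- The Hamiltonian system `(M, σ, H)` is compatible: the equation `i(X) σ = dH` has a solution
`X`, a smooth vector field defined on all of `M`. -/
def IsCompatibleSystem [IsManifold 𝓘(ℝ, E) ∞ M] (σ : TwoForm E M) (H : M → ℝ) : Prop :=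
  ∃ X : ∀ x : M, TangentSpace 𝓘(ℝ, E) x,
    ContMDiff 𝓘(ℝ, E) (𝓘(ℝ, E).prod 𝓘(ℝ, E)) ∞
      (fun x => (⟨x, X x⟩ : TangentBundle 𝓘(ℝ, E) M)) ∧
    ∀ x v, σ x ![X x, v] = mfderiv 𝓘(ℝ, E) 𝓘(ℝ, ℝ) H x v

/-- `j : (M, Ω) → (N, σ)` is a coisotropic embedding with `j^* σ = Ω`, onto a closed submanifold:
the `σ`-orthogonal complement of `T_x M` in `T_{j x} N` is contained in `T_x M`. -/
structure IsCoisotropicEmbedding (j : M → N) (Ω : TwoForm E M) (σ : TwoForm F N) : Prop where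
  embedding : Manifold.IsSmoothEmbedding 𝓘(ℝ, E) 𝓘(ℝ, F) ∞ j
  closed_range : IsClosed (range j)
  pullback_eq : pullback E j σ = Ω
  coisotropic : ∀ (x : M) (v : TangentSpace 𝓘(ℝ, F) (j x)),
    (∀ u : TangentSpace 𝓘(ℝ, E) x, σ (j x) ![v, mfderiv 𝓘(ℝ, E) 𝓘(ℝ, F) j x u] = 0) →
      ∃ u : TangentSpace 𝓘(ℝ, E) x, mfderiv 𝓘(ℝ, E) 𝓘(ℝ, F) j x u = v

/-- The equivalence relation "lying on the same leaf of the foliation generated by `ker σ`":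
the points can be joined by finitely many smooth curves that are everywhere tangent to `ker σ`. -/
def leafSetoid (σ : TwoForm E M) : Setoid M :=
  Relation.EqvGen.setoid fun x y => ∃ γ : ℝ → M,
    ContMDiff 𝓘(ℝ, ℝ) 𝓘(ℝ, E) ∞ γ ∧
    (∀ t : ℝ, mfderiv 𝓘(ℝ, ℝ) 𝓘(ℝ, E) γ t (1 : ℝ) ∈ formKer σ (γ t)) ∧ γ 0 = x ∧ γ 1 = y

/-- The leaf space `M / ker σ`, with the quotient topology. -/
abbrev LeafSpace (σ : TwoForm E M) : Type _ := Quotient (leafSetoid σ)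

/-- The canonical projection `M → M / ker σ`. -/
def leafProj (σ : TwoForm E M) : M → LeafSpace σ := Quotient.mk (leafSetoid σ)

/-- The given smooth structure makes `M / ker σ` the quotient manifold of `M` by the distribution
`ker σ`: the projection is a smooth submersion, and its fibres are tangent to the distribution. -/
structure IsQuotientManifold (EQ : Type*) [NormedAddCommGroup EQ] [NormedSpace ℝ EQ]
    (σ : TwoForm E M) [ChartedSpace EQ (LeafSpace σ)] : Prop where
  submersion : Manifold.IsSubmersion 𝓘(ℝ, E) 𝓘(ℝ, EQ) ∞ (leafProj σ)
  ker_eq : ∀ x v, mfderiv 𝓘(ℝ, E) 𝓘(ℝ, EQ) (leafProj σ) x v = 0 ↔ v ∈ formKer σ x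

end Forms

/-- A subset of a topological space that is a union of connected components of the space. -/
def IsUnionOfComponents {X : Type*} [TopologicalSpace X] (S : Set X) : Prop :=
  ∃ A : Set X, S = ⋃ x ∈ A, connectedComponent x

section Levels

variable {E F : Type*} [NormedAddCommGroup E] [NormedSpace ℝ E]
  [NormedAddCommGroup F] [NormedSpace ℝ F]
  {M N V : Type*} [TopologicalSpace M] [ChartedSpace E M]

/-- The level set `J⁻¹(μ)`, with the subspace topology. -/
abbrev Level (J : M → V) (μ : V) : Type _ := {x : M // J x = μ}

/-- `μ` is a weakly regular value of `J`: the level set `J⁻¹(μ)`, with the given smooth structure,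
is an (embedded) submanifold, and its tangent space at `x` is `ker T_x J`. -/
structure IsWeaklyRegularValue (Eμ : Type*) [NormedAddCommGroup Eμ] [NormedSpace ℝ Eμ]
    (J : M → F) (μ : F) [ChartedSpace Eμ (Level J μ)] : Prop where
  embedding : Manifold.IsSmoothEmbedding 𝓘(ℝ, Eμ) 𝓘(ℝ, E) ∞ (Subtype.val : Level J μ → M)
  tangent : ∀ (x : Level J μ) (v : TangentSpace 𝓘(ℝ, E) x.1),
    (∃ w : TangentSpace 𝓘(ℝ, Eμ) x,
      mfderiv 𝓘(ℝ, Eμ) 𝓘(ℝ, E) (Subtype.val : Level J μ → M) x w = v) ↔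
    mfderiv 𝓘(ℝ, E) 𝓘(ℝ, F) J x.1 v = 0

/-- The form `σ_μ` induced on the level set `J⁻¹(μ)` by a form `σ` on `M`. -/
def levelForm (Eμ : Type*) [NormedAddCommGroup Eμ] [NormedSpace ℝ Eμ]
    (J : M → V) (μ : V) [ChartedSpace Eμ (Level J μ)] (σ : TwoForm E M) :
    TwoForm Eμ (Level J μ) :=
  pullback Eμ (Subtype.val : Level J μ → M) σ

/-- The map `(J ∘ j)⁻¹(μ) → J⁻¹(μ)` induced by `j`. -/
def levelMap (j : M → N) (J : N → V) (μ : V) : Level (J ∘ j) μ → Level J μ :=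
  fun x => ⟨j x.1, x.2⟩

end Levels

section Actions

variable {EG : Type*} [NormedAddCommGroup EG] [NormedSpace ℝ EG]
  {E : Type*} [NormedAddCommGroup E] [NormedSpace ℝ E]
  {G : Type*} [TopologicalSpace G] [ChartedSpace EG G] [Group G]
  {M : Type*} [TopologicalSpace M] [ChartedSpace E M] [MulAction G M]

/-- The value at `x` of the fundamental vector field of `ξ ∈ 𝔤 = T_1 G`: the derivative at `1` of
the orbit map `g ↦ g • x`, in the direction `ξ`. -/
def fundamental (E : Type*) [NormedAddCommGroup E] [NormedSpace ℝ E] [ChartedSpace E M]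
    (ξ : GroupLieAlgebra 𝓘(ℝ, EG) G) (x : M) : TangentSpace 𝓘(ℝ, E) x :=
  (mfderiv 𝓘(ℝ, EG) 𝓘(ℝ, E) (fun g : G => g • x) 1 ξ : E)

/-- `G` is a symmetry group of the system `(M, σ, H)`: the action preserves `σ` and `H`. -/
structure IsSymmetryGroup (G : Type*) [Group G] [MulAction G M]
    (σ : TwoForm E M) (H : M → ℝ) : Prop where
  form_invariant : ∀ g : G, pullback E (fun x : M => g • x) σ = σ
  function_invariant : ∀ (g : G) (x : M), H (g • x) = H x

/-- `J : M → 𝔤^*` is a momentum map of a Poissonian action: it is smooth, the functions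
`f_ξ = J(·)(ξ)` satisfy `d f_ξ = i(ξ̃) σ`, and `ξ ↦ f_ξ` is a Lie algebra homomorphism for the
Poisson bracket `{f_ξ, f_η} = σ(ξ̃, η̃)`. The Lie algebra `𝔤 = T_1 G` is, as a vector space, the
model space `EG`. -/
structure IsPoissonianMomentumMap (G : Type*) [TopologicalSpace G] [ChartedSpace EG G] [Group G]
    [MulAction G M] (σ : TwoForm E M) (J : M → (EG →L[ℝ] ℝ)) : Prop where
  smooth : ContMDiff 𝓘(ℝ, E) 𝓘(ℝ, EG →L[ℝ] ℝ) ∞ J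
  hamiltonian : ∀ (ξ : GroupLieAlgebra 𝓘(ℝ, EG) G) (x : M) (v : TangentSpace 𝓘(ℝ, E) x),
    mfderiv 𝓘(ℝ, E) 𝓘(ℝ, ℝ) (fun y => J y ξ) x v = σ x ![fundamental E ξ x, v]
  poisson : ∀ (ξ η : GroupLieAlgebra 𝓘(ℝ, EG) G) (x : M),
    J x (⁅ξ, η⁆ : GroupLieAlgebra 𝓘(ℝ, EG) G) = σ x ![fundamental E ξ x, fundamental E η x]

/-- Every vector in `ker σ` is tangent to the orbit of `G` through its base point. -/
def KerTangentToOrbits (EG G : Type*) [NormedAddCommGroup EG] [NormedSpace ℝ EG]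
    [TopologicalSpace G] [ChartedSpace EG G] [Group G] [MulAction G M] (σ : TwoForm E M) : Prop :=
  ∀ x, ∀ v ∈ formKer σ x, ∃ ξ : GroupLieAlgebra 𝓘(ℝ, EG) G, fundamental E ξ x = v

end Actions

end PresymplecticReduction

end

/-! At a point of `j(M)` on the level set, let `T` be the tangent space of `M` inside that of `W`,
`O` the tangent space of the orbit, and `⊥` the `ΩW`-orthogonal. Coisotropy gives `T^⊥ ⊆ T`, so
`T^⊥` is the image of `ker Ω`, which lies in `O` because `ker Ω` is tangent to the orbits. Taking
orthogonals, `ker dJ = O^⊥ ⊆ T^⊥⊥ = T`: every vector tangent to the level set of `J` is tangent to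
`M` (`exists_tangent_of_orthogonal_orbit`). Hence `levelMap` has bijective differential and is a
local diffeomorphism. Its range is the part of the level set lying in `j(M)`, which is closed, and
it is open as well, so it is a union of components.

The reduced forms exist because a closed form is constant along its kernel. In a submersion chart
this is Cartan's formula (`eq_of_extDeriv_eq_zero_of_kernel`); connectedness of the curves that
define a leaf extends it to whole leaves (`IsQuotientManifold.existsUnique_form`).

For the leaf spaces, a curve tangent to the kernel that meets the clopen range of `levelMap` stays
in it and lifts (`exists_lift_of_leafSetoid`). So leaves correspond to leaves, the induced map is
injective, and its range has clopen preimage. Its differential is bijective because `levelMap`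
matches the two kernels (`exists_leafSpace_map`).

The Hamiltonians descend because the kernel on a level set is tangent to the orbits: in `W` it is
orthogonal to `ker dJ = O^⊥`, so it lies in `O^⊥⊥ = O` (`exists_fundamental_of_mem_formKer`). -/

noncomputable section

namespace PresymplecticReduction

open Filter Topology Manifold

/-! ### The inverse function theorem on manifolds. -/

section InverseFunction

variable {E F : Type*} [NormedAddCommGroup E] [NormedSpace ℝ E]
  [NormedAddCommGroup F] [NormedSpace ℝ F]
  {M N : Type*} [TopologicalSpace M] [ChartedSpace E M]
  [TopologicalSpace N] [ChartedSpace F N]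

/-- A smooth map between Banach spaces, with an invertible derivative at `a`, is a local
diffeomorphism at `a`. -/
theorem isLocalDiffeomorphAt_of_contDiffOn [CompleteSpace E] {g : E → F} {a : E} {s : Set E}
    (hs : IsOpen s) (ha : a ∈ s) (hg : ContDiffOn ℝ ∞ g s) (e : E ≃L[ℝ] F)
    (he : fderiv ℝ g a = e) : IsLocalDiffeomorphAt 𝓘(ℝ, E) 𝓘(ℝ, F) ∞ g a := by
  have hga : ∀ y ∈ s, ContDiffAt ℝ ∞ g y := fun y hy => hg.contDiffAt (hs.mem_nhds hy)
  have hd : HasFDerivAt g (e : E →L[ℝ] F) a :=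
    he ▸ ((hga a ha).differentiableAt (by simp)).hasFDerivAt
  set Φ := (hga a ha).toOpenPartialHomeomorph g hd (by simp) with hΦ
  have hΦg : (Φ : E → F) = g := (hga a ha).toOpenPartialHomeomorph_coe hd (by simp)
  have haΦ : a ∈ Φ.source := (hga a ha).mem_toOpenPartialHomeomorph_source hd (by simp)
  have hcont : ContinuousOn (fderiv ℝ g) s := hg.continuousOn_fderiv_of_isOpen hs (by simp)
  -- The inverse must be smooth on its whole domain, not only at `g a`. The source is therefore cut
  -- down to the points where the derivative is still invertible, an open condition.
  set t : Set E := s ∩ fderiv ℝ g ⁻¹' range ((↑) : (E ≃L[ℝ] F) → (E →L[ℝ] F)) with ht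
  have hto : IsOpen t := hcont.isOpen_inter_preimage hs ContinuousLinearEquiv.isOpen
  have hat : a ∈ t := ⟨ha, e, he.symm⟩
  set Ψ := Φ.restrOpen t hto with hΨ
  have hsrc : Ψ.source = Φ.source ∩ t := Φ.restrOpen_source t hto
  have hcoe : (Ψ : E → F) = g := hΦg
  refine ⟨⟨Ψ.toPartialEquiv, Ψ.open_source, Ψ.open_target, ?_, ?_⟩, ?_, fun y _ => ?_⟩
  · rw [contMDiffOn_iff_contDiffOn]
    intro y hy
    have : y ∈ t := (hsrc ▸ hy : y ∈ Φ.source ∩ t).2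
    exact (hcoe ▸ (hga y this.1) : ContDiffAt ℝ ∞ Ψ y).contDiffWithinAt
  · rw [contMDiffOn_iff_contDiffOn]
    intro y hy
    have hy' : Ψ.symm y ∈ t := (hsrc ▸ Ψ.map_target hy : _ ∈ Φ.source ∩ t).2
    obtain ⟨hys, e', he'⟩ := hy'
    refine (Ψ.contDiffAt_symm (f₀' := e') hy ?_ ?_).contDiffWithinAt
    · rw [hcoe, he']
      exact ((hga _ hys).differentiableAt (by simp)).hasFDerivAt
    · rw [hcoe]; exact hga _ hys
  · change a ∈ Ψ.source
    rw [hsrc]; exact ⟨haΦ, hat⟩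
  · exact (congrFun hcoe y).symm

theorem isLocalDiffeomorphAt_congr {f g : M → N} {x : M}
    (hg : IsLocalDiffeomorphAt 𝓘(ℝ, E) 𝓘(ℝ, F) ∞ g x) (h : f =ᶠ[𝓝 x] g) :
    IsLocalDiffeomorphAt 𝓘(ℝ, E) 𝓘(ℝ, F) ∞ f x := by
  obtain ⟨Φ, hx, hΦ⟩ := hg
  obtain ⟨t, hfg, hto, hxt⟩ := eventually_nhds_iff.1 h
  set Ψ := Φ.toOpenPartialHomeomorph.restrOpen t hto
  have hsrc : Ψ.source = Φ.source ∩ t := Φ.toOpenPartialHomeomorph.restrOpen_source t hto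
  refine ⟨⟨Ψ.toPartialEquiv, Ψ.open_source, Ψ.open_target, ?_, ?_⟩, ?_, fun y hy => ?_⟩
  · exact Φ.contMDiffOn_toFun.mono fun y hy => (hsrc ▸ hy : y ∈ Φ.source ∩ t).1
  · refine Φ.contMDiffOn_invFun.mono fun y hy => ?_
    have h1 : Ψ.symm y ∈ Φ.source ∩ t := hsrc ▸ Ψ.map_target hy
    have h2 : Ψ (Ψ.symm y) = y := Ψ.right_inv hy
    exact h2 ▸ Φ.map_source h1.1
  · change x ∈ Ψ.source
    rw [hsrc]; exact ⟨hx, hxt⟩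
  · have hy' : y ∈ Φ.source ∩ t := hsrc ▸ hy
    exact (hfg y hy'.2).trans (hΦ hy'.1)

theorem isLocalDiffeomorphAt_of_mem_maximalAtlas {e : OpenPartialHomeomorph M E}
    (he : e ∈ IsManifold.maximalAtlas 𝓘(ℝ, E) ∞ M) {x : M} (hx : x ∈ e.source) :
    IsLocalDiffeomorphAt 𝓘(ℝ, E) 𝓘(ℝ, E) ∞ e x :=
  ⟨⟨e.toPartialEquiv, e.open_source, e.open_target, contMDiffOn_of_mem_maximalAtlas he,
    contMDiffOn_symm_of_mem_maximalAtlas he⟩, hx, fun _ _ => rfl⟩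

theorem isLocalDiffeomorphAt_symm_of_mem_maximalAtlas {e : OpenPartialHomeomorph M E}
    (he : e ∈ IsManifold.maximalAtlas 𝓘(ℝ, E) ∞ M) {y : E} (hy : y ∈ e.target) :
    IsLocalDiffeomorphAt 𝓘(ℝ, E) 𝓘(ℝ, E) ∞ e.symm y :=
  ⟨⟨e.symm.toPartialEquiv, e.open_target, e.open_source, contMDiffOn_symm_of_mem_maximalAtlas he,
    contMDiffOn_of_mem_maximalAtlas he⟩, hy, fun _ _ => rfl⟩

theorem mfderiv_bijective_of_isLocalDiffeomorphAt {f : M → N} {x : M}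
    (hf : IsLocalDiffeomorphAt 𝓘(ℝ, E) 𝓘(ℝ, F) ∞ f x) :
    Function.Bijective (mfderiv 𝓘(ℝ, E) 𝓘(ℝ, F) f x) := by
  rw [← hf.mfderivToContinuousLinearEquiv_coe (by simp)]
  exact (hf.mfderivToContinuousLinearEquiv (by simp)).bijective

/-- The inverse function theorem for manifolds. -/
theorem isLocalDiffeomorphAt_of_mfderiv_bijective [CompleteSpace E] [CompleteSpace F]
    [IsManifold 𝓘(ℝ, E) ∞ M] [IsManifold 𝓘(ℝ, F) ∞ N] {f : M → N}
    (hf : ContMDiff 𝓘(ℝ, E) 𝓘(ℝ, F) ∞ f) (x : M)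
    (hb : Function.Bijective (mfderiv 𝓘(ℝ, E) 𝓘(ℝ, F) f x)) :
    IsLocalDiffeomorphAt 𝓘(ℝ, E) 𝓘(ℝ, F) ∞ f x := by
  set φ := chartAt E x
  set ψ := chartAt F (f x)
  have hφ : φ ∈ IsManifold.maximalAtlas 𝓘(ℝ, E) ∞ M := IsManifold.chart_mem_maximalAtlas x
  have hψ : ψ ∈ IsManifold.maximalAtlas 𝓘(ℝ, F) ∞ N := IsManifold.chart_mem_maximalAtlas (f x)
  have hxφ : x ∈ φ.source := mem_chart_source E x
  have hxψ : f x ∈ ψ.source := mem_chart_source F (f x)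
  set s : Set E := φ.target ∩ φ.symm ⁻¹' (f ⁻¹' ψ.source)
  have hso : IsOpen s := φ.symm.isOpen_inter_preimage (ψ.open_source.preimage hf.continuous)
  have hxs : φ x ∈ s := ⟨φ.map_source hxφ, by simpa [φ.left_inv hxφ] using hxψ⟩
  set g : E → F := ψ ∘ f ∘ φ.symm
  have hg : ContMDiffOn 𝓘(ℝ, E) 𝓘(ℝ, F) ∞ g s :=
    (contMDiffOn_of_mem_maximalAtlas hψ).comp
      (hf.comp_contMDiffOn ((contMDiffOn_symm_of_mem_maximalAtlas hφ).mono inter_subset_left))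
      fun y hy => hy.2
  have hφb := isLocalDiffeomorphAt_symm_of_mem_maximalAtlas hφ hxs.1
  have hψb := isLocalDiffeomorphAt_of_mem_maximalAtlas hψ hxψ
  have hsx : φ.symm (φ x) = x := φ.left_inv hxφ
  have hψd : MDifferentiableAt 𝓘(ℝ, F) 𝓘(ℝ, F) ψ (f (φ.symm (φ x))) := by
    rw [hsx]; exact hψb.mdifferentiableAt (by simp)
  have hfd : MDifferentiableAt 𝓘(ℝ, E) 𝓘(ℝ, F) f (φ.symm (φ x)) :=
    hf.mdifferentiable (by simp) _
  have hφd := hφb.mdifferentiableAt (by simp)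
  have hfd' : fderiv ℝ g (φ x) = (mfderiv 𝓘(ℝ, F) 𝓘(ℝ, F) ψ (f (φ.symm (φ x)))).comp
      ((mfderiv 𝓘(ℝ, E) 𝓘(ℝ, F) f (φ.symm (φ x))).comp
        (mfderiv 𝓘(ℝ, E) 𝓘(ℝ, E) φ.symm (φ x))) := by
    rw [← mfderiv_eq_fderiv]
    exact (mfderiv_comp (I' := 𝓘(ℝ, F)) (φ x) hψd (hfd.comp (φ x) hφd)).trans
      (by rw [mfderiv_comp (I' := 𝓘(ℝ, E)) (φ x) hfd hφd]; rfl)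
  have hbij : Function.Bijective (fderiv ℝ g (φ x)) := by
    rw [hfd']
    refine Function.Bijective.comp (g := mfderiv 𝓘(ℝ, F) 𝓘(ℝ, F) ψ (f (φ.symm (φ x)))) ?_
      (Function.Bijective.comp (g := mfderiv 𝓘(ℝ, E) 𝓘(ℝ, F) f (φ.symm (φ x))) ?_
        (mfderiv_bijective_of_isLocalDiffeomorphAt hφb))
    · rw [hsx]; exact mfderiv_bijective_of_isLocalDiffeomorphAt hψb
    · rw [hsx]; exact hb
  have hgl := isLocalDiffeomorphAt_of_contDiffOn hso hxs (contMDiffOn_iff_contDiffOn.1 hg)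
    (ContinuousLinearEquiv.ofBijective (fderiv ℝ g (φ x))
      (LinearMap.ker_eq_bot.2 hbij.1) (LinearMap.range_eq_top.2 hbij.2)) (by ext; rfl)
  have hgx : g (φ x) = ψ (f x) := by simp [g, hsx]
  have h1 := (isLocalDiffeomorphAt_of_mem_maximalAtlas hφ hxφ).comp (K := 𝓘(ℝ, F)) F hgl
  have h2 := h1.comp (K := 𝓘(ℝ, F)) N (g := ψ.symm)
    (by rw [Function.comp_apply, hgx]
        exact isLocalDiffeomorphAt_symm_of_mem_maximalAtlas hψ (ψ.map_source hxψ))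
  refine isLocalDiffeomorphAt_congr h2 ?_
  filter_upwards [φ.open_source.mem_nhds hxφ,
    (ψ.open_source.preimage hf.continuous).mem_nhds hxψ] with y hy hy'
  simp [g, φ.left_inv hy, ψ.left_inv hy']

end InverseFunction

/-! ### Consequences of the normal forms of immersions and submersions. -/

section Normal

variable {E F : Type*} [NormedAddCommGroup E] [NormedSpace ℝ E]
  [NormedAddCommGroup F] [NormedSpace ℝ F]
  {M N : Type*} [TopologicalSpace M] [ChartedSpace E M]
  [TopologicalSpace N] [ChartedSpace F N]

/-- The differential of an immersion is injective. -/
theorem mfderiv_injective_of_isImmersionAt {f : M → N} {x : M}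
    (hf : IsImmersionAt 𝓘(ℝ, E) 𝓘(ℝ, F) ∞ f x) :
    Function.Injective (mfderiv 𝓘(ℝ, E) 𝓘(ℝ, F) f x) := by
  set φ := hf.domChart
  set ψ := hf.codChart
  have hφb := isLocalDiffeomorphAt_symm_of_mem_maximalAtlas hf.domChart_mem_maximalAtlas
    (φ.map_source hf.mem_domChart_source)
  -- A local retraction: the first component in the normal form. Near `x` it satisfies `r ∘ f = id`,
  -- so the chain rule gives a left inverse of the differential.
  set r : N → M := φ.symm ∘ (fun z : F => (hf.equiv.symm z).1) ∘ ψ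
  have hw : ∀ y ∈ φ.source, (hf.equiv.symm (ψ (f y))).1 = φ y := by
    intro y hy
    have := hf.writtenInCharts (show φ y ∈ (hf.domChart.extend 𝓘(ℝ, E)).target by
      simpa using φ.map_source hy)
    simp only [OpenPartialHomeomorph.extend_coe, OpenPartialHomeomorph.extend_coe_symm,
      Function.comp_apply, modelWithCornersSelf_coe, modelWithCornersSelf_coe_symm, id] at this
    rw [show hf.domChart.symm (φ y) = y from φ.left_inv hy] at this
    rw [show ψ (f y) = _ from this]
    simp
  have hrd : MDifferentiableAt 𝓘(ℝ, F) 𝓘(ℝ, E) r (f x) := by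
    refine MDifferentiableAt.comp (I' := 𝓘(ℝ, E)) (f x) ?_
      (MDifferentiableAt.comp (I' := 𝓘(ℝ, F)) (f x) ?_
        ((isLocalDiffeomorphAt_of_mem_maximalAtlas hf.codChart_mem_maximalAtlas
          hf.mem_codChart_source).mdifferentiableAt (by simp)))
    · rw [Function.comp_apply, hw x hf.mem_domChart_source]
      exact hφb.mdifferentiableAt (by simp)
    · exact (differentiableAt_fst.comp _ hf.equiv.symm.differentiableAt).mdifferentiableAt
  have hfd : MDifferentiableAt 𝓘(ℝ, E) 𝓘(ℝ, F) f x := hf.contMDiffAt.mdifferentiableAt (by simp)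
  have hid : r ∘ f =ᶠ[𝓝 x] id := by
    filter_upwards [φ.open_source.mem_nhds hf.mem_domChart_source] with y hy
    simp only [r, Function.comp_apply, hw y hy, φ.left_inv hy, id]
  have hc := mfderiv_comp (I' := 𝓘(ℝ, F)) x hrd hfd
  rw [hid.mfderiv_eq, mfderiv_id] at hc
  exact Function.LeftInverse.injective (g := mfderiv 𝓘(ℝ, F) 𝓘(ℝ, E) r (f x))
    fun v => (DFunLike.congr_fun hc v).symm

/-- A submersion has smooth local sections through every point. -/
theorem exists_local_section_of_isSubmersionAt {f : M → N} {x : M}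
    (hf : IsSubmersionAt 𝓘(ℝ, E) 𝓘(ℝ, F) ∞ f x) :
    ∃ (s : N → M) (V : Set N), IsOpen V ∧ f x ∈ V ∧ ContMDiffOn 𝓘(ℝ, F) 𝓘(ℝ, E) ∞ s V ∧
      s (f x) = x ∧ ∀ q ∈ V, f (s q) = q := by
  set φ := hf.domChart
  set ψ := hf.codChart
  -- The complementary coordinate is frozen at its value at `x`, so that the section passes through
  -- `x`.
  set l : F → E := fun z => hf.equiv.symm (z, (hf.equiv (φ x)).2)
  have hl : ContDiff ℝ ∞ l := hf.equiv.symm.contDiff.comp (contDiff_id.prodMk contDiff_const)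
  have hw : ∀ y ∈ φ.target, ψ (f (φ.symm y)) = (hf.equiv y).1 := by
    intro y hy
    have := hf.writtenInCharts (show y ∈ (hf.domChart.extend 𝓘(ℝ, E)).target by simpa using hy)
    simpa using this
  have hx : φ.symm (φ x) = x := φ.left_inv hf.mem_domChart_source
  have hlx : l (ψ (f x)) = φ x := by
    have := hw (φ x) (φ.map_source hf.mem_domChart_source)
    rw [hx] at this
    simp [l, this]
  set V : Set N := ψ.source ∩ ψ ⁻¹' (l ⁻¹' φ.target)
  have hV : IsOpen V := ψ.isOpen_inter_preimage (φ.open_target.preimage hl.continuous)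
  refine ⟨φ.symm ∘ l ∘ ψ, V, hV, ⟨hf.mem_codChart_source, ?_⟩, ?_, ?_, ?_⟩
  · simpa [hlx] using φ.map_source hf.mem_domChart_source
  · exact (contMDiffOn_symm_of_mem_maximalAtlas hf.domChart_mem_maximalAtlas).comp
      (hl.contMDiff.comp_contMDiffOn
        ((contMDiffOn_of_mem_maximalAtlas hf.codChart_mem_maximalAtlas).mono inter_subset_left))
      fun q hq => hq.2
  · simp [hlx, hx]
  · intro q hq
    have h1 := hw (l (ψ q)) hq.2
    refine ψ.injOn (hf.source_subset_preimage_source (φ.map_target hq.2)) hq.1 (h1.trans ?_)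
    simp [l]

/-- The differential of a submersion is surjective. -/
theorem mfderiv_surjective_of_isSubmersionAt {f : M → N} {x : M}
    (hf : IsSubmersionAt 𝓘(ℝ, E) 𝓘(ℝ, F) ∞ f x) :
    Function.Surjective (mfderiv 𝓘(ℝ, E) 𝓘(ℝ, F) f x) := by
  obtain ⟨s, V, hV, hxV, hs, hsx, hfs⟩ := exists_local_section_of_isSubmersionAt hf
  have hsd : MDifferentiableAt 𝓘(ℝ, F) 𝓘(ℝ, E) s (f x) :=
    (hs.contMDiffAt (hV.mem_nhds hxV)).mdifferentiableAt (by simp)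
  have hfd : MDifferentiableAt 𝓘(ℝ, E) 𝓘(ℝ, F) f (s (f x)) := by
    rw [hsx]; exact hf.contMDiffAt.mdifferentiableAt (by simp)
  have hid : f ∘ s =ᶠ[𝓝 (f x)] id := by
    filter_upwards [hV.mem_nhds hxV] with q hq using hfs q hq
  have hc := mfderiv_comp (I' := 𝓘(ℝ, E)) (f x) hfd hsd
  rw [hid.mfderiv_eq, mfderiv_id] at hc
  have hsurj : Function.Surjective (mfderiv 𝓘(ℝ, E) 𝓘(ℝ, F) f (s (f x))) := fun v =>
    ⟨mfderiv 𝓘(ℝ, F) 𝓘(ℝ, E) s (f x) v, (DFunLike.congr_fun hc v).symm⟩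
  rwa [hsx] at hsurj

variable {E' P : Type*} [NormedAddCommGroup E'] [NormedSpace ℝ E'] [TopologicalSpace P]
  [ChartedSpace E' P]

/-- A map out of the target of a surjective submersion is smooth if its composition with the
submersion is. -/
theorem contMDiff_of_comp_isSubmersion {π : M → N} (hπ : IsSubmersion 𝓘(ℝ, E) 𝓘(ℝ, F) ∞ π)
    (hsurj : Function.Surjective π) {h : N → P}
    (hh : ContMDiff 𝓘(ℝ, E) 𝓘(ℝ, E') ∞ (h ∘ π)) : ContMDiff 𝓘(ℝ, F) 𝓘(ℝ, E') ∞ h := by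
  intro q
  obtain ⟨x, rfl⟩ := hsurj q
  obtain ⟨s, V, hV, hxV, hs, -, hfs⟩ := exists_local_section_of_isSubmersionAt (hπ.isSubmersionAt x)
  refine ((hh.comp_contMDiffOn hs).contMDiffAt (hV.mem_nhds hxV)).congr_of_eventuallyEq ?_
  filter_upwards [hV.mem_nhds hxV] with q hq
  simp [hfs q hq]

end Normal

/-! ### Smooth dependence of a linear pull-back on the 2-form and the linear map. -/

section Multilinear

variable {X E F : Type*} [NormedAddCommGroup X] [NormedSpace ℝ X] [NormedAddCommGroup E]
  [NormedSpace ℝ E] [NormedAddCommGroup F] [NormedSpace ℝ F]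

/-- Antisymmetrisation of continuous bilinear forms, normalised so as to be a left inverse of the
inclusion of the alternating forms. -/
def antisymmetrization (E : Type*) [NormedAddCommGroup E] [NormedSpace ℝ E] :
    ContinuousMultilinearMap ℝ (fun _ : Fin 2 => E) ℝ →L[ℝ] E [⋀^Fin 2]→L[ℝ] ℝ :=
  LinearMap.mkContinuous
    { toFun := fun f => (2⁻¹ : ℝ) • f.alternatization
      map_add' := fun f g => by simp
      map_smul' := fun c f => by
        ext v
        simp only [ContinuousAlternatingMap.smul_apply,
          ContinuousMultilinearMap.alternatization_apply_apply, RingHom.id_apply,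
          _root_.smul_apply, smul_comm _ c, ← Finset.smul_sum] }
    -- Each of the two permutations contributes at most `‖f‖ * ∏ ‖v i‖`, and the factor `2⁻¹` brings
    -- the sum back to constant `1`.
    1 (fun f => by
      refine ContinuousAlternatingMap.opNorm_le_bound (f := (2⁻¹ : ℝ) • f.alternatization)
        (by positivity) fun v => ?_
      have h : ∀ σ : Equiv.Perm (Fin 2), ‖Equiv.Perm.sign σ • f (v ∘ σ)‖ ≤ ‖f‖ * ∏ i, ‖v i‖ := by
        intro σ
        have h1 : ‖Equiv.Perm.sign σ • f (v ∘ σ)‖ = ‖f (v ∘ σ)‖ := by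
          rcases Int.units_eq_one_or (Equiv.Perm.sign σ) with h | h <;> simp [h]
        rw [h1, ← Equiv.prod_comp σ fun i => ‖v i‖]
        exact f.le_opNorm _
      have h2 := (norm_sum_le Finset.univ fun σ : Equiv.Perm (Fin 2) =>
        Equiv.Perm.sign σ • f (v ∘ σ)).trans (Finset.sum_le_sum fun σ _ => h σ)
      rw [Finset.sum_const, Finset.card_univ, Fintype.card_perm] at h2
      simp only [ContinuousAlternatingMap.smul_apply,
        ContinuousMultilinearMap.alternatization_apply_apply, norm_smul, one_mul]
      norm_num at h2 ⊢
      linarith)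

theorem antisymmetrization_coe (f : E [⋀^Fin 2]→L[ℝ] ℝ) :
    antisymmetrization E f.toContinuousMultilinearMap = f := by
  ext v
  have h : ∀ σ : Equiv.Perm (Fin 2), Equiv.Perm.sign σ • f (v ∘ σ) = f v := by
    intro σ
    have := f.toAlternatingMap.map_perm v σ
    rw [show f (v ∘ σ) = Equiv.Perm.sign σ • f v from this, smul_smul, Int.units_mul_self,
      one_smul]
  have h2 : (∑ σ : Equiv.Perm (Fin 2), Equiv.Perm.sign σ • f (v ∘ σ)) = 2 * f v := by
    rw [Finset.sum_congr rfl fun σ _ => h σ, Finset.sum_const, Finset.card_univ,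
      Fintype.card_perm]
    simp
  change (2⁻¹ : ℝ) • (f.toContinuousMultilinearMap.alternatization v) = f v
  rw [ContinuousMultilinearMap.alternatization_apply_apply]
  refine (congrArg ((2⁻¹ : ℝ) • ·) h2).trans ?_
  simp

/-- Among all multilinear maps, composition is itself continuous multilinear in the linear maps,
hence smooth. The continuous linear map `antisymmetrization` carries this smoothness back to
alternating forms. -/
theorem contDiffAt_compContinuousLinearMap {n : WithTop ℕ∞} {α : X → F [⋀^Fin 2]→L[ℝ] ℝ}
    {g : X → E →L[ℝ] F} {x : X} (hα : ContDiffAt ℝ n α x) (hg : ContDiffAt ℝ n g x) :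
    ContDiffAt ℝ n (fun y => (α y).compContinuousLinearMap (g y)) x := by
  have h1 : ContDiffAt ℝ n (fun y =>
      ContinuousMultilinearMap.compContinuousLinearMapContinuousMultilinear ℝ
        (fun _ : Fin 2 => E) (fun _ : Fin 2 => F) ℝ fun _ => g y) x :=
    (ContinuousMultilinearMap.contDiff _).contDiffAt.comp x (contDiffAt_pi.2 fun _ => hg)
  have h2 := h1.clm_apply
    ((ContinuousAlternatingMap.toContinuousMultilinearMapCLM ℝ).contDiff.contDiffAt.comp x hα)
  have h3 := (antisymmetrization E).contDiff.contDiffAt.comp x h2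
  refine h3.congr_of_eventuallyEq (Eventually.of_forall fun y => ?_)
  exact (antisymmetrization_coe ((α y).compContinuousLinearMap (g y))).symm

end Multilinear

/-! ### Pull-backs of differential 2-forms: functoriality, smoothness, closedness. -/

section Pullback

variable {E F E' : Type*} [NormedAddCommGroup E] [NormedSpace ℝ E]
  [NormedAddCommGroup F] [NormedSpace ℝ F] [NormedAddCommGroup E'] [NormedSpace ℝ E']
  {M N P : Type*} [TopologicalSpace M] [ChartedSpace E M]
  [TopologicalSpace N] [ChartedSpace F N] [TopologicalSpace P] [ChartedSpace E' P]

theorem pullback_comp_apply {f : P → M} {g : M → N} {x : P} (σ : TwoForm F N)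
    (hg : MDifferentiableAt 𝓘(ℝ, E) 𝓘(ℝ, F) g (f x))
    (hf : MDifferentiableAt 𝓘(ℝ, E') 𝓘(ℝ, E) f x) :
    pullback E' (g ∘ f) σ x = pullback E' f (pullback E g σ) x := by
  simp only [pullback]
  rw [mfderiv_comp (I' := 𝓘(ℝ, E)) x hg hf]
  rfl

theorem pullback_congr {f g : M → N} {x : M} (σ : TwoForm F N) (h : f =ᶠ[𝓝 x] g) :
    pullback E f σ x = pullback E g σ x := by
  have h1 : f x = g x := h.self_of_nhds
  have h2 : mfderiv 𝓘(ℝ, E) 𝓘(ℝ, F) f x = (mfderiv 𝓘(ℝ, E) 𝓘(ℝ, F) g x : E →L[ℝ] F) :=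
    h.mfderiv_eq
  -- The two forms live over points that are only propositionally equal; generalising point and
  -- differential together allows the substitution.
  have h3 : ∀ (p q : N) (A B : E →L[ℝ] F), p = q → A = B →
      ContinuousAlternatingMap.compContinuousLinearMap (σ p : F [⋀^Fin 2]→L[ℝ] ℝ) A =
        ContinuousAlternatingMap.compContinuousLinearMap (σ q : F [⋀^Fin 2]→L[ℝ] ℝ) B := by
    rintro p _ A _ rfl rfl; rfl
  exact h3 _ _ _ _ h1 h2

theorem pullback_apply (f : M → N) (σ : TwoForm F N) (x : M) (v w : TangentSpace 𝓘(ℝ, E) x) :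
    pullback E f σ x ![v, w] =
      σ (f x) ![mfderiv 𝓘(ℝ, E) 𝓘(ℝ, F) f x v, mfderiv 𝓘(ℝ, E) 𝓘(ℝ, F) f x w] := by
  change σ (f x) (_ ∘ ![v, w]) = _
  congr 1
  ext i
  fin_cases i <;> rfl

/-- The pull-back of a 2-form along a map from a vector space, as a map into the fixed space of
2-forms on that vector space. -/
def flatForm (f : E' → N) (σ : TwoForm F N) : E' → E' [⋀^Fin 2]→L[ℝ] ℝ := pullback E' f σ

/-- In a chart of the target, the pull-back along a map from a vector space is the pull-back of the
coordinate expression. -/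
theorem flatForm_eventuallyEq_inChart {f : E' → N} {U : Set E'} (hU : IsOpen U)
    (hf : ContMDiffOn 𝓘(ℝ, E') 𝓘(ℝ, F) ∞ f U) (σ : TwoForm F N)
    {e : OpenPartialHomeomorph N F} (he : e ∈ IsManifold.maximalAtlas 𝓘(ℝ, F) ∞ N) {y : E'}
    (hy : y ∈ U) (hye : f y ∈ e.source) :
    ContDiffAt ℝ ∞ (e ∘ f) y ∧
    flatForm f σ =ᶠ[𝓝 y]
      fun z => (inChart σ e ((e ∘ f) z)).compContinuousLinearMap (fderiv ℝ (e ∘ f) z) := by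
  set V : Set E' := U ∩ f ⁻¹' e.source
  have hV : IsOpen V := hf.continuousOn.isOpen_inter_preimage hU e.open_source
  have hg : ContMDiffOn 𝓘(ℝ, E') 𝓘(ℝ, F) ∞ (e ∘ f) V :=
    (contMDiffOn_of_mem_maximalAtlas he).comp (hf.mono inter_subset_left) fun z hz => hz.2
  refine ⟨((contMDiffOn_iff_contDiffOn.1 hg).contDiffAt (hV.mem_nhds ⟨hy, hye⟩)), ?_⟩
  filter_upwards [hV.mem_nhds ⟨hy, hye⟩] with z hz
  have hzV := hV.mem_nhds hz
  have hgz : MDifferentiableAt 𝓘(ℝ, E') 𝓘(ℝ, F) (e ∘ f) z :=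
    (hg.contMDiffAt hzV).mdifferentiableAt (by simp)
  have hez : MDifferentiableAt 𝓘(ℝ, F) 𝓘(ℝ, F) e.symm ((e ∘ f) z) :=
    (isLocalDiffeomorphAt_symm_of_mem_maximalAtlas he (e.map_source hz.2)).mdifferentiableAt
      (by simp)
  have hfg : f =ᶠ[𝓝 z] e.symm ∘ (e ∘ f) := by
    filter_upwards [hzV] with w hw using (e.left_inv hw.2).symm
  refine (pullback_congr σ hfg).trans ((pullback_comp_apply σ hez hgz).trans ?_)
  simp only [pullback, mfderiv_eq_fderiv]
  rfl

theorem contDiffAt_flatForm [IsManifold 𝓘(ℝ, F) ∞ N] {f : E' → N} {U : Set E'} (hU : IsOpen U)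
    (hf : ContMDiffOn 𝓘(ℝ, E') 𝓘(ℝ, F) ∞ f U) {σ : TwoForm F N} (hσ : IsSmoothForm σ) {y : E'}
    (hy : y ∈ U) : ContDiffAt ℝ ∞ (flatForm f σ) y := by
  have he := IsManifold.chart_mem_maximalAtlas (I := 𝓘(ℝ, F)) (n := ∞) (f y)
  have hye := mem_chart_source F (f y)
  obtain ⟨h1, h2⟩ := flatForm_eventuallyEq_inChart hU hf σ he hy hye
  refine (contDiffAt_compContinuousLinearMap ?_ ?_).congr_of_eventuallyEq h2
  · exact ((hσ _ he).contDiffAt ((chartAt F (f y)).open_target.mem_nhds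
      ((chartAt F (f y)).map_source hye))).comp y h1
  · exact h1.fderiv_right (by simp)

/-- The exterior derivative commutes with pull-back, and in a chart at `f y` the form is the
pull-back of a closed coordinate expression. -/
theorem extDeriv_flatForm_eq_zero [IsManifold 𝓘(ℝ, F) ∞ N] {f : E' → N} {U : Set E'}
    (hU : IsOpen U) (hf : ContMDiffOn 𝓘(ℝ, E') 𝓘(ℝ, F) ∞ f U) {σ : TwoForm F N}
    (hσ : IsSmoothForm σ) (hd : IsClosedForm σ) {y : E'} (hy : y ∈ U) :
    extDeriv (flatForm f σ) y = 0 := by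
  have he := IsManifold.chart_mem_maximalAtlas (I := 𝓘(ℝ, F)) (n := ∞) (f y)
  have hye := mem_chart_source F (f y)
  obtain ⟨h1, h2⟩ := flatForm_eventuallyEq_inChart hU hf σ he hy hye
  have het := (chartAt F (f y)).map_source hye
  have hs := ((hσ _ he).contDiffAt ((chartAt F (f y)).open_target.mem_nhds het)).differentiableAt
    (by simp)
  rw [h2.extDeriv_eq, extDeriv_pullback (f := chartAt F (f y) ∘ f) (r := 2) hs (h1.of_le (WithTop.coe_le_coe.2 (le_top : (2 : ℕ∞) ≤ ⊤))) (by simp)]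
  rw [show extDeriv (inChart σ (chartAt F (f y))) ((chartAt F (f y) ∘ f) y) = 0 from
    hd _ he _ het]
  rfl

/-- The coordinate expression of a pull-back. -/
theorem inChart_pullback {f : M → N} (hf : ContMDiff 𝓘(ℝ, E) 𝓘(ℝ, F) ∞ f) (σ : TwoForm F N)
    {e : OpenPartialHomeomorph M E} (he : e ∈ IsManifold.maximalAtlas 𝓘(ℝ, E) ∞ M) {y : E}
    (hy : y ∈ e.target) : inChart (pullback E f σ) e y = flatForm (f ∘ e.symm) σ y :=
  (pullback_comp_apply σ (hf.mdifferentiable (by simp) _)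
    ((isLocalDiffeomorphAt_symm_of_mem_maximalAtlas he hy).mdifferentiableAt (by simp))).symm

theorem IsSmoothForm.pullback [IsManifold 𝓘(ℝ, F) ∞ N] {f : M → N}
    (hf : ContMDiff 𝓘(ℝ, E) 𝓘(ℝ, F) ∞ f) {σ : TwoForm F N} (hσ : IsSmoothForm σ) :
    IsSmoothForm (PresymplecticReduction.pullback E f σ) := by
  intro e he y hy
  refine ContDiffAt.contDiffWithinAt ?_
  refine (contDiffAt_flatForm e.open_target
    (hf.comp_contMDiffOn (contMDiffOn_symm_of_mem_maximalAtlas he)) hσ hy).congr_of_eventuallyEq ?_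
  filter_upwards [e.open_target.mem_nhds hy] with z hz using inChart_pullback hf σ he hz

theorem IsClosedForm.pullback [IsManifold 𝓘(ℝ, F) ∞ N] {f : M → N}
    (hf : ContMDiff 𝓘(ℝ, E) 𝓘(ℝ, F) ∞ f) {σ : TwoForm F N} (hσ : IsSmoothForm σ)
    (hd : IsClosedForm σ) : IsClosedForm (PresymplecticReduction.pullback E f σ) := by
  intro e he y hy
  have h : inChart (PresymplecticReduction.pullback E f σ) e =ᶠ[𝓝 y]
      flatForm (f ∘ e.symm) σ := by
    filter_upwards [e.open_target.mem_nhds hy] with z hz using inChart_pullback hf σ he hz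
  exact h.extDeriv_eq.trans (extDeriv_flatForm_eq_zero e.open_target
    (hf.comp_contMDiffOn (contMDiffOn_symm_of_mem_maximalAtlas he)) hσ hd hy)

end Pullback

/-! ### Closed 2-forms on a vector space. -/

section Flat

variable {E : Type*} [NormedAddCommGroup E] [NormedSpace ℝ E]

theorem ext_twoForm {α β : E [⋀^Fin 2]→L[ℝ] ℝ} (h : ∀ v w, α ![v, w] = β ![v, w]) : α = β := by
  ext v
  have : v = ![v 0, v 1] := by ext i; fin_cases i <;> rfl
  rw [this]; exact h _ _

theorem map_swap_twoForm (α : E [⋀^Fin 2]→L[ℝ] ℝ) (v w : E) : α ![w, v] = -α ![v, w] := by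
  have h := α.toAlternatingMap.map_swap ![v, w] (show (0 : Fin 2) ≠ 1 by decide)
  have e : ![v, w] ∘ Equiv.swap (0 : Fin 2) 1 = ![w, v] := by ext i; fin_cases i <;> simp
  rw [e] at h
  exact h

/-- A closed 2-form is constant along the segments in whose direction it is degenerate. -/
theorem eq_of_extDeriv_eq_zero_of_kernel {α : E → E [⋀^Fin 2]→L[ℝ] ℝ} {s : Set E}
    (hs : IsOpen s) (hc : Convex ℝ s) (hα : ∀ z ∈ s, DifferentiableAt ℝ α z)
    (hd : ∀ z ∈ s, extDeriv α z = 0) {y k : E} (hy : y ∈ s) (hyk : y + k ∈ s)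
    (hk : ∀ z ∈ s, ∀ w, α z ![k, w] = 0) : α (y + k) = α y := by
  refine ext_twoForm fun v w => ?_
  have hev : ∀ z ∈ s, ∀ m : Fin 2 → E, DifferentiableAt ℝ (fun p => α p m) z := fun z hz m =>
    (ContinuousAlternatingMap.apply ℝ E ℝ m).differentiableAt.comp z (hα z hz)
  -- Cartan's formula for the constant field `k`: in `dα(k, v, w)` the terms differentiating `α(k,
  -- w)` and `α(k, v)` vanish since `k` lies in the kernel throughout `s`. What remains is the
  -- derivative of `α(v, w)` along `k`.
  have hzero : ∀ z ∈ s, fderiv ℝ (fun p => α p ![v, w]) z k = 0 := by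
    intro z hz
    have h0 : ∀ u : E, fderiv ℝ (fun p => α p ![k, u]) z = 0 := by
      intro u
      have : (fun p => α p ![k, u]) =ᶠ[𝓝 z] fun _ => (0 : ℝ) := by
        filter_upwards [hs.mem_nhds hz] with p hp using hk p hp u
      rw [this.fderiv_eq]; simp
    have h1 := extDeriv_apply (hα z hz) ![k, v, w]
    rw [hd z hz, Fin.sum_univ_three] at h1
    have e0 : (0 : Fin 3).removeNth ![k, v, w] = ![v, w] := by ext i; fin_cases i <;> rfl
    have e1 : (1 : Fin 3).removeNth ![k, v, w] = ![k, w] := by ext i; fin_cases i <;> rfl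
    have e2 : (2 : Fin 3).removeNth ![k, v, w] = ![k, v] := by ext i; fin_cases i <;> rfl
    rw [e0, e1, e2, h0, h0] at h1
    simpa using h1.symm
  have hseg : ∀ t ∈ Icc (0 : ℝ) 1, y + t • k ∈ s := fun t ht => by
    have := hc.add_smul_sub_mem hy hyk ht
    simpa using this
  have hder : ∀ t ∈ Icc (0 : ℝ) 1, HasDerivAt (fun t : ℝ => α (y + t • k) ![v, w]) 0 t := by
    intro t ht
    have h1 : HasDerivAt (fun t : ℝ => y + t • k) k t := by
      simpa using ((hasDerivAt_id t).smul_const k).const_add y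
    have h2 := (hev _ (hseg t ht) ![v, w]).hasFDerivAt.comp_hasDerivAt t h1
    rwa [hzero _ (hseg t ht)] at h2
  have := constant_of_has_deriv_right_zero (f := fun t : ℝ => α (y + t • k) ![v, w])
    (fun t ht => (hder t ht).continuousAt.continuousWithinAt)
    (fun t ht => (hder t (Ico_subset_Icc_self ht)).hasDerivWithinAt) 1 (right_mem_Icc.2 zero_le_one)
  simpa using this

end Flat

/-! ### Leaves of the kernel, and descent of a closed form along a fibre. -/

section Leaves

variable {E : Type*} [NormedAddCommGroup E] [NormedSpace ℝ E]
  {N : Type*} [TopologicalSpace N] [ChartedSpace E N]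

theorem surjective_leafProj (σ : TwoForm E N) : Function.Surjective (leafProj σ) :=
  Quotient.mk_surjective

/-- A smooth curve tangent to `ker σ` stays in a leaf. -/
theorem leafProj_curve {σ : TwoForm E N} {γ : ℝ → N} (hγ : ContMDiff 𝓘(ℝ, ℝ) 𝓘(ℝ, E) ∞ γ)
    (hk : ∀ t : ℝ, mfderiv 𝓘(ℝ, ℝ) 𝓘(ℝ, E) γ t (1 : ℝ) ∈ formKer σ (γ t)) (t : ℝ) :
    leafProj σ (γ t) = leafProj σ (γ 0) := by
  -- The relation asks for a curve from time `0` to time `1`; running `γ` at speed `t` reaches `γ t`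
  -- at time `1`.
  refine (Quotient.sound (s := leafSetoid σ) (Relation.EqvGen.rel (γ 0) (γ t)
    ⟨fun s => γ (s * t), ?_, fun s => ?_, by simp, by simp⟩)).symm
  · exact hγ.comp ((contDiff_id.mul contDiff_const).contMDiff)
  · have hm : HasDerivAt (fun s : ℝ => s * t) t s := by
      simpa using (hasDerivAt_id s).mul_const t
    have hd := mfderiv_comp (I' := 𝓘(ℝ, ℝ)) s (hγ.mdifferentiable (by simp) (s * t))
      hm.differentiableAt.mdifferentiableAt
    have h1 : mfderiv 𝓘(ℝ, ℝ) 𝓘(ℝ, E) (fun s => γ (s * t)) s (1 : ℝ) =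
        (t • mfderiv 𝓘(ℝ, ℝ) 𝓘(ℝ, E) γ (s * t) (1 : ℝ) : E) := by
      refine (DFunLike.congr_fun hd (1 : ℝ)).trans ?_
      rw [mfderiv_eq_fderiv]
      change mfderiv 𝓘(ℝ, ℝ) 𝓘(ℝ, E) γ (s * t) (fderiv ℝ (fun s : ℝ => s * t) s 1) = _
      rw [fderiv_eq_smul_deriv, one_smul, hm.deriv]
      have h2 : (t : ℝ) = t • (1 : ℝ) := by simp
      exact (congrArg (mfderiv 𝓘(ℝ, ℝ) 𝓘(ℝ, E) γ (s * t)) h2).trans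
        ((mfderiv 𝓘(ℝ, ℝ) 𝓘(ℝ, E) γ (s * t)).map_smul t (1 : ℝ))
    exact h1 ▸ (formKer σ (γ (s * t))).smul_mem t (hk (s * t))

/-- A property of points that is locally constant along the curves tangent to `ker σ` is constant
on the leaves. -/
theorem iff_of_leafProj_eq {σ : TwoForm E N} {p : N → Prop}
    (hp : ∀ x, ∃ U ∈ 𝓝 x, ∀ y ∈ U, leafProj σ y = leafProj σ x → (p y ↔ p x))
    {x y : N} (h : leafProj σ x = leafProj σ y) : p x ↔ p y := by
  have h' : Relation.EqvGen _ x y := Quotient.exact h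
  induction h' with
  | rel x y hxy =>
    obtain ⟨γ, hγ, hk, rfl, rfl⟩ := hxy
    have : IsLocallyConstant fun t => p (γ t) := by
      rw [IsLocallyConstant.iff_eventually_eq]
      intro t
      obtain ⟨U, hU, hpU⟩ := hp (γ t)
      filter_upwards [hγ.continuous.continuousAt.preimage_mem_nhds hU] with s hs
      exact propext (hpU _ hs ((leafProj_curve hγ hk s).trans (leafProj_curve hγ hk t).symm))
    rw [this.apply_eq_of_preconnectedSpace 0 1]
  | refl x => rfl
  | symm x y hxy ih => exact (ih h.symm).symm
  | trans x y z hxy hyz ih1 ih2 =>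
    exact (ih1 (Quotient.sound hxy)).trans (ih2 (Quotient.sound hyz))

variable {E' : Type*} [NormedAddCommGroup E'] [NormedSpace ℝ E']
  {Q : Type*} [TopologicalSpace Q] [ChartedSpace E' Q]

/-- The 2-form `σ_x` is the pull-back of `τ` by the differential of `π` at `x`. -/
def DescendsAt (π : N → Q) (σ : TwoForm E N) (τ : E' [⋀^Fin 2]→L[ℝ] ℝ) (x : N) : Prop :=
  ∀ v w : TangentSpace 𝓘(ℝ, E) x,
    τ ![mfderiv 𝓘(ℝ, E) 𝓘(ℝ, E') π x v, mfderiv 𝓘(ℝ, E) 𝓘(ℝ, E') π x w] = σ x ![v, w]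

theorem descendsAt_of_pullback_eq {π : N → Q} {σ : TwoForm E N} {τ : TwoForm E' Q}
    (h : pullback E π τ = σ) (x : N) : DescendsAt (E' := E') π σ (τ (π x)) x := fun v w =>
  (pullback_apply π τ x v w).symm.trans (by rw [h])

theorem pullback_eq_of_descendsAt {π : N → Q} {σ : TwoForm E N} {τ : TwoForm E' Q}
    (h : ∀ x, DescendsAt (E' := E') π σ (τ (π x)) x) : pullback E π τ = σ := by
  funext x
  exact ext_twoForm (E := E) fun v w => (pullback_apply π τ x v w).trans (h x v w)

theorem DescendsAt.unique {π : N → Q} {σ : TwoForm E N} {τ τ' : E' [⋀^Fin 2]→L[ℝ] ℝ} {x : N}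
    (hs : Function.Surjective (mfderiv 𝓘(ℝ, E) 𝓘(ℝ, E') π x))
    (h : DescendsAt π σ τ x) (h' : DescendsAt π σ τ' x) : τ = τ' := by
  refine ext_twoForm fun v w => ?_
  obtain ⟨v, rfl⟩ := hs v
  obtain ⟨w, rfl⟩ := hs w
  exact (h v w).trans (h' v w).symm

/-- Pull `σ x` back along a linear right inverse `r` of the differential `A`. Since `r (A v) - v`
lies in `ker A`, hence in the kernel of `σ x`, replacing `v` by `r (A v)` does not change the value.
-/
theorem exists_descendsAt [FiniteDimensional ℝ E'] {π : N → Q} {σ : TwoForm E N} {x : N}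
    (hs : Function.Surjective (mfderiv 𝓘(ℝ, E) 𝓘(ℝ, E') π x))
    (hk : ∀ v, mfderiv 𝓘(ℝ, E) 𝓘(ℝ, E') π x v = 0 → v ∈ formKer σ x) :
    ∃ τ : E' [⋀^Fin 2]→L[ℝ] ℝ, DescendsAt π σ τ x := by
  let A : E →L[ℝ] E' := mfderiv 𝓘(ℝ, E) 𝓘(ℝ, E') π x
  let α : E [⋀^Fin 2]→L[ℝ] ℝ := σ x
  obtain ⟨r, hr⟩ := A.toLinearMap.exists_rightInverse_of_surjective (LinearMap.range_eq_top.2 hs)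
  have hr' : ∀ u, A (r u) = u := fun u => LinearMap.congr_fun hr u
  have hkA : ∀ v : E, A v = 0 → ∀ w, α ![v, w] = 0 := fun v hv w => hk v hv w
  have hadd : ∀ v v' w : E, α ![v - v', w] = 0 → α ![v, w] = α ![v', w] := by
    intro v v' w h
    have e : ∀ u, Function.update ![v, w] 0 u = ![u, w] := by
      intro u; ext i; fin_cases i <;> simp
    have h2 := α.toAlternatingMap.map_update_sub ![v, w] 0 v v'
    rw [e, e, e] at h2
    exact sub_eq_zero.1 (h2.symm.trans h)
  refine ⟨α.compContinuousLinearMap r.toContinuousLinearMap, fun v w => ?_⟩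
  have h1 : ∀ v w : E, α ![r (A v), w] = α ![v, w] := fun v w =>
    hadd _ _ _ (hkA _ (by rw [map_sub, hr', sub_self]) w)
  have h3 : ∀ v w : E, α ![r (A v), r (A w)] = α ![v, w] := fun v w => by
    rw [h1, map_swap_twoForm, h1, ← map_swap_twoForm]
  refine Eq.trans ?_ (h3 v w)
  change α (_ ∘ ![A v, A w]) = _
  congr 1
  ext i; fin_cases i <;> rfl

/-- Near a point, a form that descends pointwise along a submersion `π`, and is closed, descends to
the same form on the points of a fibre of `π`. -/
theorem exists_nhds_descendsAt_iff [IsManifold 𝓘(ℝ, E) ∞ N] {π : N → Q} {x : N}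
    (hπ : IsSubmersionAt 𝓘(ℝ, E) 𝓘(ℝ, E') ∞ π x) (hπd : ContMDiff 𝓘(ℝ, E) 𝓘(ℝ, E') ∞ π)
    {σ : TwoForm E N} (hσ : IsSmoothForm σ) (hd : IsClosedForm σ)
    (hk : ∀ x v, mfderiv 𝓘(ℝ, E) 𝓘(ℝ, E') π x v = 0 → v ∈ formKer σ x)
    (τ : E' [⋀^Fin 2]→L[ℝ] ℝ) :
    ∃ U ∈ 𝓝 x, ∀ y ∈ U, π y = π x → (DescendsAt π σ τ y ↔ DescendsAt π σ τ x) := by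
  set φ := hπ.domChart
  set ψ := hπ.codChart
  set L := hπ.equiv
  have hφ := hπ.domChart_mem_maximalAtlas
  have hψ := hπ.codChart_mem_maximalAtlas
  have hxφ : x ∈ φ.source := hπ.mem_domChart_source
  set α := inChart σ φ
  set A : E → E →L[ℝ] E' := fun y => mfderiv 𝓘(ℝ, E) 𝓘(ℝ, E') (π ∘ φ.symm) y
  have hw : ∀ y ∈ φ.target, ψ (π (φ.symm y)) = (L y).1 := by
    intro y hy
    have := hπ.writtenInCharts (show y ∈ (hπ.domChart.extend 𝓘(ℝ, E)).target by simpa using hy)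
    simpa using this
  have hsrc : ∀ y ∈ φ.target, π (φ.symm y) ∈ ψ.source := fun y hy =>
    hπ.source_subset_preimage_source (φ.map_target hy)
  have hφd : ∀ y ∈ φ.target, MDifferentiableAt 𝓘(ℝ, E) 𝓘(ℝ, E) φ.symm y := fun y hy =>
    (isLocalDiffeomorphAt_symm_of_mem_maximalAtlas hφ hy).mdifferentiableAt (by simp)
  -- In the normal form `A y` depends on `y` only through `(L y).1`, so it is the same at all points
  -- of a fibre in the chart.
  have hAψ : ∀ y ∈ φ.target, ∀ v : E, A y v =
      mfderiv 𝓘(ℝ, E') 𝓘(ℝ, E') ψ.symm (L y).1 (L v).1 := by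
    intro y hy v
    have hyt : (L y).1 ∈ ψ.target := by rw [← hw y hy]; exact ψ.map_source (hsrc y hy)
    have h1 : π ∘ φ.symm =ᶠ[𝓝 y] ψ.symm ∘ fun z => (L z).1 := by
      filter_upwards [φ.open_target.mem_nhds hy] with z hz
      rw [Function.comp_apply, Function.comp_apply, ← hw z hz, ψ.left_inv (hsrc z hz)]
    have hl : HasFDerivAt (fun z : E => (L z).1)
        ((ContinuousLinearMap.fst ℝ E' hπ.complement).comp (L : E →L[ℝ] E' × hπ.complement)) y :=
      ((ContinuousLinearMap.fst ℝ E' hπ.complement).comp (L : E →L[ℝ] E' × hπ.complement)).hasFDerivAt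
    have h2 := mfderiv_comp (I' := 𝓘(ℝ, E')) (f := fun z : E => (L z).1) y
      ((isLocalDiffeomorphAt_symm_of_mem_maximalAtlas hψ hyt).mdifferentiableAt (by simp))
      hl.differentiableAt.mdifferentiableAt
    rw [← h1.mfderiv_eq, mfderiv_eq_fderiv, hl.fderiv] at h2
    exact DFunLike.congr_fun h2 v
  have hAφ : ∀ y ∈ φ.target, ∀ v : E, A y v = mfderiv 𝓘(ℝ, E) 𝓘(ℝ, E') π (φ.symm y)
      (mfderiv 𝓘(ℝ, E) 𝓘(ℝ, E) φ.symm y v) := fun y hy v =>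
    DFunLike.congr_fun (mfderiv_comp (I' := 𝓘(ℝ, E)) y (hπd.mdifferentiable (by simp) _)
      (hφd y hy)) v
  have hα : ∀ y v w, α y ![v, w] = σ (φ.symm y)
      ![mfderiv 𝓘(ℝ, E) 𝓘(ℝ, E) φ.symm y v, mfderiv 𝓘(ℝ, E) 𝓘(ℝ, E) φ.symm y w] := fun y v w =>
    pullback_apply φ.symm σ y v w
  have hD : ∀ y ∈ φ.target,
      (DescendsAt π σ τ (φ.symm y) ↔ ∀ v w : E, τ ![A y v, A y w] = α y ![v, w]) := by
    intro y hy
    constructor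
    · intro h v w
      rw [hAφ y hy, hAφ y hy, hα]
      exact h _ _
    · intro h v w
      have hs : ∀ u : E, ∃ v : E, mfderiv 𝓘(ℝ, E) 𝓘(ℝ, E) φ.symm y v = u :=
        (mfderiv_bijective_of_isLocalDiffeomorphAt
          (isLocalDiffeomorphAt_symm_of_mem_maximalAtlas hφ hy)).2
      obtain ⟨v, rfl⟩ := hs v
      obtain ⟨w, rfl⟩ := hs w
      have := h v w
      rwa [hAφ y hy, hAφ y hy, hα] at this
  -- A ball is convex, so the segment joining two of its points stays in the chart.
  obtain ⟨ε, hε, hB⟩ := Metric.isOpen_iff.1 φ.open_target _ (φ.map_source hxφ)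
  have hBo : IsOpen (Metric.ball (φ x) ε) := Metric.isOpen_ball
  refine ⟨φ.source ∩ φ ⁻¹' Metric.ball (φ x) ε, (φ.isOpen_inter_preimage hBo).mem_nhds
    ⟨hxφ, Metric.mem_ball_self hε⟩, fun y hy hyx => ?_⟩
  have hyt := φ.map_source hy.1
  have hxt := φ.map_source hxφ
  have hLe : (L (φ y)).1 = (L (φ x)).1 := by
    rw [← hw _ hyt, ← hw _ hxt, φ.left_inv hy.1, φ.left_inv hxφ, hyx]
  -- For two points of one fibre, `φ y - φ x` has zero first component. It is thus killed by the
  -- differential of `π`, hence lies in the kernel of `α`, at every point of the ball.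
  have hαe : α (φ x + (φ y - φ x)) = α (φ x) := by
    refine eq_of_extDeriv_eq_zero_of_kernel hBo (convex_ball _ _)
      (fun z hz => ((hσ φ hφ).contDiffAt (φ.open_target.mem_nhds (hB hz))).differentiableAt
        (by simp)) (fun z hz => hd φ hφ z (hB hz)) (Metric.mem_ball_self hε)
      (by simpa using hy.2) fun z hz w => ?_
    rw [hα]
    refine hk _ _ ?_ _
    rw [← hAφ z (hB hz), hAψ z (hB hz), map_sub, Prod.fst_sub, hLe, sub_self]
    exact map_zero _
  rw [add_sub_cancel] at hαe
  have hy1 := hD _ hyt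
  have hx1 := hD _ hxt
  rw [φ.left_inv hy.1] at hy1
  rw [φ.left_inv hxφ] at hx1
  rw [hy1, hx1]
  refine forall₂_congr fun v w => ?_
  rw [hαe, hAψ _ hyt, hAψ _ hyt, hAψ _ hxt, hAψ _ hxt, hLe]

end Leaves

/-! ### Forms and functions on the leaf space. -/

section Quotient

variable {E : Type*} [NormedAddCommGroup E] [NormedSpace ℝ E]
  {N : Type*} [TopologicalSpace N] [ChartedSpace E N]
  {EQ : Type*} [NormedAddCommGroup EQ] [NormedSpace ℝ EQ]
  {σ : TwoForm E N} [ChartedSpace EQ (LeafSpace σ)]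

theorem IsQuotientManifold.surjective_mfderiv (hQ : IsQuotientManifold EQ σ) (x : N) :
    Function.Surjective (mfderiv 𝓘(ℝ, E) 𝓘(ℝ, EQ) (leafProj σ) x) :=
  mfderiv_surjective_of_isSubmersionAt (hQ.submersion.isSubmersionAt x)

/-- A closed form descends to a unique smooth form on the leaf space of its kernel. -/
theorem IsQuotientManifold.existsUnique_form [FiniteDimensional ℝ EQ] [IsManifold 𝓘(ℝ, E) ∞ N]
    (hQ : IsQuotientManifold EQ σ) (hσ : IsSmoothForm σ) (hd : IsClosedForm σ) :
    ∃! τ : TwoForm EQ (LeafSpace σ), IsSmoothForm τ ∧ pullback E (leafProj σ) τ = σ := by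
  have hk : ∀ x v, mfderiv 𝓘(ℝ, E) 𝓘(ℝ, EQ) (leafProj σ) x v = 0 → v ∈ formKer σ x :=
    fun x v => (hQ.ker_eq x v).1
  have hex : ∀ q : LeafSpace σ, ∃ τ : EQ [⋀^Fin 2]→L[ℝ] ℝ,
      ∀ x, leafProj σ x = q → DescendsAt (leafProj σ) σ τ x := by
    intro q
    obtain ⟨x, rfl⟩ := surjective_leafProj σ q
    obtain ⟨τ, hτ⟩ := exists_descendsAt (hQ.surjective_mfderiv x) (hk x)
    -- A form chosen at one point of the leaf works on all of it, since "descends to `τ`" is locally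
    -- constant along the leaf.
    refine ⟨τ, fun y hy => (iff_of_leafProj_eq (fun z => ?_) hy).2 hτ⟩
    exact exists_nhds_descendsAt_iff (hQ.submersion.isSubmersionAt z) hQ.submersion.contMDiff
      hσ hd hk τ
  choose τ hτ using hex
  have hpb : pullback E (leafProj σ) (τ : TwoForm EQ (LeafSpace σ)) = σ :=
    pullback_eq_of_descendsAt fun x => hτ _ x rfl
  refine ⟨τ, ⟨fun e he y hy => ?_, hpb⟩, fun τ' hτ' => ?_⟩
  -- With a local section `s` of the projection `π`, `τ = (π ∘ s)^* τ = s^* σ` near the point, which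
  -- is smooth.
  · obtain ⟨x, hx⟩ := surjective_leafProj σ (e.symm y)
    obtain ⟨s, V, hV, hxV, hs, -, hfs⟩ :=
      exists_local_section_of_isSubmersionAt (hQ.submersion.isSubmersionAt x)
    have hes := contMDiffOn_symm_of_mem_maximalAtlas he
    set U : Set EQ := e.target ∩ e.symm ⁻¹' V
    have hU : IsOpen U := e.symm.isOpen_inter_preimage hV
    have hyU : y ∈ U := ⟨hy, show e.symm y ∈ V from hx ▸ hxV⟩
    have hse : ContMDiffOn 𝓘(ℝ, EQ) 𝓘(ℝ, E) ∞ (s ∘ e.symm) U :=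
      hs.comp (hes.mono inter_subset_left) fun z hz => hz.2
    refine ((contDiffAt_flatForm hU hse hσ hyU).congr_of_eventuallyEq ?_).contDiffWithinAt
    filter_upwards [hU.mem_nhds hyU] with z hz
    have hid : e.symm =ᶠ[𝓝 z] leafProj σ ∘ (s ∘ e.symm) := by
      filter_upwards [hU.mem_nhds hz] with w hw using (hfs _ hw.2).symm
    refine (pullback_congr (E := EQ) τ hid).trans ((pullback_comp_apply τ
      (hQ.submersion.contMDiff.mdifferentiable (by simp) _)
      ((hse.contMDiffAt (hU.mem_nhds hz)).mdifferentiableAt (by simp))).trans ?_)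
    rw [hpb]
    rfl
  · funext q
    obtain ⟨x, rfl⟩ := surjective_leafProj σ q
    exact (descendsAt_of_pullback_eq (E' := EQ) hτ'.2 x).unique (E' := EQ) (hQ.surjective_mfderiv x) (hτ _ x rfl)

/-- A function whose differential vanishes on `ker σ` descends to a unique smooth function on the
leaf space. -/
theorem IsQuotientManifold.existsUnique_function (hQ : IsQuotientManifold EQ σ) {h : N → ℝ}
    (hh : ContMDiff 𝓘(ℝ, E) 𝓘(ℝ, ℝ) ∞ h)
    (hk : ∀ x, ∀ v ∈ formKer σ x, mfderiv 𝓘(ℝ, E) 𝓘(ℝ, ℝ) h x v = 0) :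
    ∃! f : LeafSpace σ → ℝ, ContMDiff 𝓘(ℝ, EQ) 𝓘(ℝ, ℝ) ∞ f ∧ ∀ x, f (leafProj σ x) = h x := by
  have hcurve : ∀ γ : ℝ → N, ContMDiff 𝓘(ℝ, ℝ) 𝓘(ℝ, E) ∞ γ →
      (∀ t : ℝ, mfderiv 𝓘(ℝ, ℝ) 𝓘(ℝ, E) γ t (1 : ℝ) ∈ formKer σ (γ t)) → h (γ 0) = h (γ 1) := by
    intro γ hγ hγk
    have hd : Differentiable ℝ (h ∘ γ) :=
      (contMDiff_iff_contDiff.1 (hh.comp hγ)).differentiable (by simp)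
    refine is_const_of_deriv_eq_zero hd (fun t => ?_) 0 1
    have hc := mfderiv_comp (I' := 𝓘(ℝ, E)) t (hh.mdifferentiable (by simp) (γ t))
      (hγ.mdifferentiable (by simp) t)
    rw [mfderiv_eq_fderiv] at hc
    rw [← fderiv_apply_one_eq_deriv]
    exact (DFunLike.congr_fun hc (1 : ℝ)).trans (hk _ _ (hγk t))
  have hrel : ∀ x y, (leafSetoid σ) x y → h x = h y := by
    intro x y hxy
    induction hxy with
    | rel x y hxy =>
      obtain ⟨γ, hγ, hγk, rfl, rfl⟩ := hxy
      exact hcurve γ hγ hγk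
    | refl x => rfl
    | symm x y _ ih => exact ih.symm
    | trans x y z _ _ ih1 ih2 => exact ih1.trans ih2
  refine ⟨Quotient.lift h hrel, ⟨?_, fun x => rfl⟩, fun f hf => ?_⟩
  · exact contMDiff_of_comp_isSubmersion hQ.submersion (surjective_leafProj σ) hh
  · funext q
    obtain ⟨x, rfl⟩ := surjective_leafProj σ q
    exact hf.2 x

end Quotient

section Components

theorem isUnionOfComponents_of_isClopen {X : Type*} [TopologicalSpace X] {S : Set X}
    (hS : IsClopen S) : IsUnionOfComponents S :=
  ⟨S, Subset.antisymm (fun _ hx => mem_biUnion hx mem_connectedComponent)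
    (iUnion₂_subset fun _ hx => hS.connectedComponent_subset hx)⟩

end Components

/-! ### Commutative squares of smooth maps. -/

section Square

variable {E₁ E₂ E₃ E₄ : Type*} [NormedAddCommGroup E₁] [NormedSpace ℝ E₁]
  [NormedAddCommGroup E₂] [NormedSpace ℝ E₂] [NormedAddCommGroup E₃] [NormedSpace ℝ E₃]
  [NormedAddCommGroup E₄] [NormedSpace ℝ E₄]
  {M₁ M₂ M₃ M₄ : Type*} [TopologicalSpace M₁] [ChartedSpace E₁ M₁]
  [TopologicalSpace M₂] [ChartedSpace E₂ M₂] [TopologicalSpace M₃] [ChartedSpace E₃ M₃]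
  [TopologicalSpace M₄] [ChartedSpace E₄ M₄]

/-- The differential of a commutative square of smooth maps. -/
theorem mfderiv_square {f : M₁ → M₂} {g : M₂ → M₄} {h : M₁ → M₃} {k : M₃ → M₄}
    (e : g ∘ f = k ∘ h) (hf : ContMDiff 𝓘(ℝ, E₁) 𝓘(ℝ, E₂) ∞ f)
    (hg : ContMDiff 𝓘(ℝ, E₂) 𝓘(ℝ, E₄) ∞ g) (hh : ContMDiff 𝓘(ℝ, E₁) 𝓘(ℝ, E₃) ∞ h)
    (hk : ContMDiff 𝓘(ℝ, E₃) 𝓘(ℝ, E₄) ∞ k) (x : M₁) (v : E₁) :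
    (mfderiv 𝓘(ℝ, E₂) 𝓘(ℝ, E₄) g (f x) (mfderiv 𝓘(ℝ, E₁) 𝓘(ℝ, E₂) f x v) : E₄) =
      mfderiv 𝓘(ℝ, E₃) 𝓘(ℝ, E₄) k (h x) (mfderiv 𝓘(ℝ, E₁) 𝓘(ℝ, E₃) h x v) := by
  have h1 := mfderiv_comp (I' := 𝓘(ℝ, E₂)) x (hg.mdifferentiable (by simp) (f x))
    (hf.mdifferentiable (by simp) x)
  have h2 := mfderiv_comp (I' := 𝓘(ℝ, E₃)) x (hk.mdifferentiable (by simp) (h x))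
    (hh.mdifferentiable (by simp) x)
  have h3 : (mfderiv 𝓘(ℝ, E₁) 𝓘(ℝ, E₄) (g ∘ f) x : E₁ →L[ℝ] E₄) =
      mfderiv 𝓘(ℝ, E₁) 𝓘(ℝ, E₄) (k ∘ h) x := by rw [e]
  exact (DFunLike.congr_fun h1 v).symm.trans
    ((DFunLike.congr_fun h3 v).trans (DFunLike.congr_fun h2 v))

theorem pullback_square {f : M₁ → M₂} {g : M₂ → M₄} {h : M₁ → M₃} {k : M₃ → M₄}
    (e : g ∘ f = k ∘ h) (hf : ContMDiff 𝓘(ℝ, E₁) 𝓘(ℝ, E₂) ∞ f)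
    (hg : ContMDiff 𝓘(ℝ, E₂) 𝓘(ℝ, E₄) ∞ g) (hh : ContMDiff 𝓘(ℝ, E₁) 𝓘(ℝ, E₃) ∞ h)
    (hk : ContMDiff 𝓘(ℝ, E₃) 𝓘(ℝ, E₄) ∞ k) (σ : TwoForm E₄ M₄) :
    pullback E₁ f (pullback E₂ g σ) = pullback E₁ h (pullback E₃ k σ) := by
  funext x
  rw [← pullback_comp_apply σ (hg.mdifferentiable (by simp) (f x))
    (hf.mdifferentiable (by simp) x), ← pullback_comp_apply σ (hk.mdifferentiable (by simp) (h x))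
    (hh.mdifferentiable (by simp) x), e]

end Square

/-! ### Local diffeomorphisms preserving the forms, and the induced maps of leaf spaces. -/

section LocalDiffeomorphism

variable {E E' : Type*} [NormedAddCommGroup E] [NormedSpace ℝ E]
  [NormedAddCommGroup E'] [NormedSpace ℝ E']
  {N N' : Type*} [TopologicalSpace N] [ChartedSpace E N] [TopologicalSpace N'] [ChartedSpace E' N']
  {f : N → N'} {σ : TwoForm E N} {σ' : TwoForm E' N'}

/-- Surjectivity of the differential matters when pushing forward: every test vector at `f x` must
come from one at `x`. -/
theorem mfderiv_mem_formKer_iff (hf : IsLocalDiffeomorph 𝓘(ℝ, E) 𝓘(ℝ, E') ∞ f)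
    (hpb : pullback E f σ' = σ) (x : N) (v : TangentSpace 𝓘(ℝ, E) x) :
    mfderiv 𝓘(ℝ, E) 𝓘(ℝ, E') f x v ∈ formKer σ' (f x) ↔ v ∈ formKer σ x := by
  have h : ∀ w, σ x ![v, w] = σ' (f x) ![mfderiv 𝓘(ℝ, E) 𝓘(ℝ, E') f x v,
      mfderiv 𝓘(ℝ, E) 𝓘(ℝ, E') f x w] := fun w => by rw [← hpb]; exact pullback_apply f σ' x v w
  constructor
  · intro hv w
    rw [h]; exact hv _
  · intro hv w
    obtain ⟨w, rfl⟩ := (mfderiv_bijective_of_isLocalDiffeomorphAt (hf x)).2 w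
    rw [← h]; exact hv w

theorem leafSetoid_map (hf : IsLocalDiffeomorph 𝓘(ℝ, E) 𝓘(ℝ, E') ∞ f)
    (hpb : pullback E f σ' = σ) {x y : N} (h : leafSetoid σ x y) :
    leafSetoid σ' (f x) (f y) := by
  induction h with
  | rel x y hxy =>
    obtain ⟨γ, hγ, hk, rfl, rfl⟩ := hxy
    refine Relation.EqvGen.rel _ _ ⟨f ∘ γ, hf.contMDiff.comp hγ, fun t => ?_, rfl, rfl⟩
    have h1 := mfderiv_comp (I' := 𝓘(ℝ, E)) t (hf.mdifferentiable (by simp) (γ t))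
      (hγ.mdifferentiable (by simp) t)
    rw [h1]
    exact (mfderiv_mem_formKer_iff hf hpb _ _).2 (hk t)
  | refl x => exact Relation.EqvGen.refl _
  | symm x y _ ih => exact Relation.EqvGen.symm _ _ ih
  | trans x y z _ _ ih1 ih2 => exact Relation.EqvGen.trans _ _ _ ih1 ih2

/-- A lift of a smooth map along an injective local diffeomorphism is smooth. -/
theorem contMDiff_of_comp_isLocalDiffeomorph {X : Type*} {B : Type*} [NormedAddCommGroup B]
    [NormedSpace ℝ B] [TopologicalSpace X] [ChartedSpace B X]
    (hf : IsLocalDiffeomorph 𝓘(ℝ, E) 𝓘(ℝ, E') ∞ f) (hinj : Function.Injective f) {c : X → N}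
    (hc : ContMDiff 𝓘(ℝ, B) 𝓘(ℝ, E') ∞ (f ∘ c)) : ContMDiff 𝓘(ℝ, B) 𝓘(ℝ, E) ∞ c := by
  intro t
  have hft := hf (c t)
  refine (hft.localInverse_contMDiffAt.comp t hc.contMDiffAt).congr_of_eventuallyEq ?_
  filter_upwards [hc.continuous.continuousAt.preimage_mem_nhds
    (hft.localInverse_open_source.mem_nhds hft.localInverse_mem_source)] with s hs
  exact hinj (hft.localInverse_right_inv hs).symm

/-- Leaves meeting the clopen image of an injective local diffeomorphism lift. -/
theorem exists_lift_of_leafSetoid (hf : IsLocalDiffeomorph 𝓘(ℝ, E) 𝓘(ℝ, E') ∞ f)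
    (hinj : Function.Injective f) (hcl : IsClosed (range f)) (hpb : pullback E f σ' = σ)
    {a b : N'} (h : leafSetoid σ' a b) :
    (∀ x, f x = a → ∃ y, f y = b ∧ leafSetoid σ x y) ∧
      (∀ y, f y = b → ∃ x, f x = a ∧ leafSetoid σ x y) := by
  -- Both lifting directions are proved together because the `symm` case exchanges them.
  induction h with
  | rel a b hab =>
    obtain ⟨γ, hγ, hk, rfl, rfl⟩ := hab
    have key : (∃ t, γ t ∈ range f) → ∃ x y, f x = γ 0 ∧ f y = γ 1 ∧ leafSetoid σ x y := by
      rintro ⟨t, ht⟩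
      -- The preimage of a clopen set in the connected line is everything once it is nonempty, so
      -- the whole curve lifts.
      have hu : γ ⁻¹' range f = univ :=
        (IsClopen.preimage ⟨hcl, hf.isOpen_range⟩ hγ.continuous).eq_univ ⟨t, ht⟩
      have hr : ∀ t, ∃ x, f x = γ t := fun t => (hu ▸ mem_univ t : t ∈ γ ⁻¹' range f)
      choose c hc using hr
      have hfc : f ∘ c = γ := funext hc
      have hcs : ContMDiff 𝓘(ℝ, ℝ) 𝓘(ℝ, E) ∞ c :=
        contMDiff_of_comp_isLocalDiffeomorph hf hinj (hfc ▸ hγ)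
      refine ⟨c 0, c 1, hc 0, hc 1, Relation.EqvGen.rel _ _ ⟨c, hcs, fun s => ?_, rfl, rfl⟩⟩
      rw [← mfderiv_mem_formKer_iff hf hpb]
      subst hfc
      have h1 := mfderiv_comp (I' := 𝓘(ℝ, E)) s (hf.mdifferentiable (by simp) (c s))
        (hcs.mdifferentiable (by simp) s)
      have h2 := hk s
      rw [h1] at h2
      exact h2
    constructor
    · intro x hx
      obtain ⟨x', y, h0, h1, h2⟩ := key ⟨0, x, hx⟩
      obtain rfl : x' = x := hinj (h0.trans hx.symm)
      exact ⟨y, h1, h2⟩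
    · intro y hy
      obtain ⟨x, y', h0, h1, h2⟩ := key ⟨1, y, hy⟩
      obtain rfl : y' = y := hinj (h1.trans hy.symm)
      exact ⟨x, h0, h2⟩
  | refl a =>
    exact ⟨fun x hx => ⟨x, hx, Relation.EqvGen.refl _⟩, fun x hx => ⟨x, hx, Relation.EqvGen.refl _⟩⟩
  | symm a b _ ih =>
    refine ⟨fun x hx => ?_, fun x hx => ?_⟩
    · obtain ⟨y, hy, h⟩ := ih.2 x hx
      exact ⟨y, hy, Relation.EqvGen.symm _ _ h⟩
    · obtain ⟨y, hy, h⟩ := ih.1 x hx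
      exact ⟨y, hy, Relation.EqvGen.symm _ _ h⟩
  | trans a b c _ _ ih1 ih2 =>
    refine ⟨fun x hx => ?_, fun x hx => ?_⟩
    · obtain ⟨y, hy, h⟩ := ih1.1 x hx
      obtain ⟨z, hz, h'⟩ := ih2.1 y hy
      exact ⟨z, hz, Relation.EqvGen.trans _ _ _ h h'⟩
    · obtain ⟨y, hy, h⟩ := ih2.2 x hx
      obtain ⟨z, hz, h'⟩ := ih1.2 y hy
      exact ⟨z, hz, Relation.EqvGen.trans _ _ _ h' h⟩

variable {EQ FQ : Type*} [NormedAddCommGroup EQ] [NormedSpace ℝ EQ] [FiniteDimensional ℝ EQ]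
  [NormedAddCommGroup FQ] [NormedSpace ℝ FQ] [FiniteDimensional ℝ FQ]
  [ChartedSpace EQ (LeafSpace σ)] [IsManifold 𝓘(ℝ, EQ) ∞ (LeafSpace σ)]
  [ChartedSpace FQ (LeafSpace σ')] [IsManifold 𝓘(ℝ, FQ) ∞ (LeafSpace σ')]

/-- An injective local diffeomorphism with closed range that preserves the forms induces an
injective local diffeomorphism with clopen range between the leaf spaces. -/
theorem exists_leafSpace_map (hf : IsLocalDiffeomorph 𝓘(ℝ, E) 𝓘(ℝ, E') ∞ f)
    (hinj : Function.Injective f) (hcl : IsClosed (range f)) (hpb : pullback E f σ' = σ)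
    (hQ : IsQuotientManifold EQ σ) (hQ' : IsQuotientManifold FQ σ') :
    ∃ jr : LeafSpace σ → LeafSpace σ', (∀ x, jr (leafProj σ x) = leafProj σ' (f x)) ∧
      Function.Injective jr ∧ IsLocalDiffeomorph 𝓘(ℝ, EQ) 𝓘(ℝ, FQ) ∞ jr ∧
      IsClopen (range jr) ∧
      ∀ (τ : TwoForm EQ (LeafSpace σ)) (τ' : TwoForm FQ (LeafSpace σ')),
        pullback E (leafProj σ) τ = σ → pullback E' (leafProj σ') τ' = σ' →
        pullback EQ jr τ' = τ := by
  let jr : LeafSpace σ → LeafSpace σ' :=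
    Quotient.map f fun x y h => leafSetoid_map hf hpb h
  have hjr : ∀ x, jr (leafProj σ x) = leafProj σ' (f x) := fun x => rfl
  have hcomp : jr ∘ leafProj σ = leafProj σ' ∘ f := funext hjr
  have hsm : ContMDiff 𝓘(ℝ, EQ) 𝓘(ℝ, FQ) ∞ jr :=
    contMDiff_of_comp_isSubmersion hQ.submersion (surjective_leafProj σ)
      (hcomp ▸ hQ'.submersion.contMDiff.comp hf.contMDiff)
  have hsq := mfderiv_square hcomp hQ.submersion.contMDiff hsm hf.contMDiff
    hQ'.submersion.contMDiff
  have := FiniteDimensional.complete ℝ EQ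
  have := FiniteDimensional.complete ℝ FQ
  refine ⟨jr, hjr, ?_, ?_, ?_, ?_⟩
  · intro p q hpq
    obtain ⟨x, rfl⟩ := surjective_leafProj σ p
    obtain ⟨y, rfl⟩ := surjective_leafProj σ q
    obtain ⟨y', hy', h⟩ := (exists_lift_of_leafSetoid hf hinj hcl hpb
      (Quotient.exact (s := leafSetoid σ') hpq)).1 x rfl
    obtain rfl : y' = y := hinj hy'
    exact Quotient.sound (s := leafSetoid σ) h
  · intro q
    obtain ⟨x, rfl⟩ := surjective_leafProj σ q
    refine isLocalDiffeomorphAt_of_mfderiv_bijective hsm _ ⟨?_, ?_⟩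
    -- Let `π`, `π'` be the projections. If `d jr (dπ v) = 0`, then `dπ' (df v) = 0`, so `df v ∈ ker
    -- σ'`, hence `v ∈ ker σ` and `dπ v = 0`.
    · refine (injective_iff_map_eq_zero _).2 fun u hu => ?_
      obtain ⟨v, rfl⟩ := hQ.surjective_mfderiv x u
      exact (hQ.ker_eq x v).2 ((mfderiv_mem_formKer_iff hf hpb x v).1
        ((hQ'.ker_eq _ _).1 ((hsq x v).symm.trans hu)))
    · intro u
      obtain ⟨w, hw⟩ := hQ'.surjective_mfderiv (f x) u
      obtain ⟨v, rfl⟩ := (mfderiv_bijective_of_isLocalDiffeomorphAt (hf x)).2 w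
      exact ⟨_, (hsq x v).trans hw⟩
  -- The range of `f` is saturated, because a leaf that meets it lifts; the quotient topology then
  -- makes `range jr` clopen.
  · have hpre : leafProj σ' ⁻¹' range jr = range f := by
      ext a
      constructor
      · rintro ⟨p, hp⟩
        obtain ⟨x, rfl⟩ := surjective_leafProj σ p
        obtain ⟨y, hy, -⟩ := (exists_lift_of_leafSetoid hf hinj hcl hpb
          (Quotient.exact (s := leafSetoid σ') hp)).1 x rfl
        exact ⟨y, hy⟩
      · rintro ⟨x, rfl⟩
        exact ⟨leafProj σ x, rfl⟩
    have hq : IsQuotientMap (leafProj σ') := isQuotientMap_quot_mk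
    rw [← hq.isClopen_preimage, hpre]
    exact ⟨hcl, hf.isOpen_range⟩
  · intro τ τ' hτ hτ'
    have h1 := pullback_square hcomp hQ.submersion.contMDiff hsm hf.contMDiff
      hQ'.submersion.contMDiff τ'
    rw [hτ', hpb] at h1
    funext q
    obtain ⟨x, rfl⟩ := surjective_leafProj σ q
    exact (descendsAt_of_pullback_eq (E' := EQ) h1 x).unique (E' := EQ) (hQ.surjective_mfderiv x)
      (descendsAt_of_pullback_eq (E' := EQ) hτ x)

end LocalDiffeomorphism

/-! ### Double orthogonals in a symplectic vector space. -/

section Symplectic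

variable {E : Type*} [NormedAddCommGroup E] [NormedSpace ℝ E]

/-- The bilinear form underlying an alternating 2-form. -/
def toBilinForm (α : E [⋀^Fin 2]→L[ℝ] ℝ) : LinearMap.BilinForm ℝ E :=
  have e : ∀ v w u : E, Function.update ![v, w] 0 u = ![u, w] := by
    intro v w u; ext i; fin_cases i <;> simp
  have e' : ∀ v w u : E, Function.update ![v, w] 1 u = ![v, u] := by
    intro v w u; ext i; fin_cases i <;> simp
  LinearMap.mk₂ ℝ (fun v w => α ![v, w])
    (fun v v' w => by
      have h := α.toAlternatingMap.map_update_add ![v, w] 0 v v'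
      rw [e, e, e] at h; exact h)
    (fun c v w => by
      have h := α.toAlternatingMap.map_update_smul ![v, w] 0 c v
      rw [e, e] at h; exact h)
    (fun v w w' => by
      have h := α.toAlternatingMap.map_update_add ![v, w] 1 w w'
      rw [e', e', e'] at h; exact h)
    (fun c v w => by
      have h := α.toAlternatingMap.map_update_smul ![v, w] 1 c w
      rw [e', e'] at h; exact h)

theorem toBilinForm_apply (α : E [⋀^Fin 2]→L[ℝ] ℝ) (v w : E) :
    toBilinForm α v w = α ![v, w] := rfl

/-- A subspace of a symplectic vector space contains its double orthogonal complement. -/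
theorem mem_of_double_orthogonal [FiniteDimensional ℝ E] {α : E [⋀^Fin 2]→L[ℝ] ℝ}
    (hα : ∀ v, (∀ w, α ![v, w] = 0) → v = 0) (S : Submodule ℝ E) {v : E}
    (hv : ∀ u, (∀ s ∈ S, α ![u, s] = 0) → α ![u, v] = 0) : v ∈ S := by
  have hr : (toBilinForm α).IsRefl := by
    intro v w h
    rw [toBilinForm_apply] at h ⊢
    rw [map_swap_twoForm, h, neg_zero]
  have hn : (toBilinForm α).Nondegenerate :=
    ⟨hα, fun w h => hα w fun v => hr _ _ (h v)⟩
  rw [← LinearMap.BilinForm.orthogonal_orthogonal hn hr S]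
  intro u hu
  refine hv u fun s hs => ?_
  rw [map_swap_twoForm]
  exact neg_eq_zero.2 (hu s hs)

end Symplectic

/-! ### Fundamental vector fields under equivariant and invariant maps. -/

section Actions

variable {EG : Type*} [NormedAddCommGroup EG] [NormedSpace ℝ EG]
  {G : Type*} [TopologicalSpace G] [ChartedSpace EG G] [Group G]
  {E : Type*} [NormedAddCommGroup E] [NormedSpace ℝ E]
  {M : Type*} [TopologicalSpace M] [ChartedSpace E M] [MulAction G M]
  [ContMDiffSMul 𝓘(ℝ, EG) 𝓘(ℝ, E) ∞ G M]
  {F : Type*} [NormedAddCommGroup F] [NormedSpace ℝ F]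
  {W : Type*} [TopologicalSpace W] [ChartedSpace F W]

theorem contMDiff_orbitMap (x : M) : ContMDiff 𝓘(ℝ, EG) 𝓘(ℝ, E) ∞ (fun g : G => g • x) :=
  contMDiff_id.smul contMDiff_const

/-- The differential of a smooth map on a fundamental vector. -/
theorem mfderiv_fundamental {f : M → W} (hf : ContMDiff 𝓘(ℝ, E) 𝓘(ℝ, F) ∞ f)
    (ξ : GroupLieAlgebra 𝓘(ℝ, EG) G) (x : M) :
    (mfderiv 𝓘(ℝ, E) 𝓘(ℝ, F) f x (fundamental E ξ x) : F) =
      mfderiv 𝓘(ℝ, EG) 𝓘(ℝ, F) (fun g : G => f (g • x)) 1 ξ := by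
  have h := mfderiv_comp (I' := 𝓘(ℝ, E)) (f := fun g : G => g • x) (1 : G)
    (hf.mdifferentiable (by simp) _) ((contMDiff_orbitMap (EG := EG) (E := E) x).mdifferentiable (by simp) _)
  -- The chain rule produces the differential at `1 • x`, which has to be transported to `x`.
  have h1 : ∀ p : M, p = x → (mfderiv 𝓘(ℝ, E) 𝓘(ℝ, F) f p : E →L[ℝ] F) =
      mfderiv 𝓘(ℝ, E) 𝓘(ℝ, F) f x := by
    rintro _ rfl
    rfl
  exact (DFunLike.congr_fun (h1 ((1 : G) • x) (one_smul G x)) (fundamental E ξ x)).symm.trans (DFunLike.congr_fun h ξ).symm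

theorem mfderiv_fundamental_of_equivariant [MulAction G W] {f : M → W}
    (hf : ContMDiff 𝓘(ℝ, E) 𝓘(ℝ, F) ∞ f) (hfG : ∀ (g : G) (x : M), f (g • x) = g • f x)
    (ξ : GroupLieAlgebra 𝓘(ℝ, EG) G) (x : M) :
    (mfderiv 𝓘(ℝ, E) 𝓘(ℝ, F) f x (fundamental E ξ x) : F) = fundamental F ξ (f x) := by
  have h : (fun g : G => f (g • x)) = fun g => g • f x := funext fun g => hfG g x
  exact (mfderiv_fundamental hf ξ x).trans
    (congrArg (fun k : G → W => (mfderiv 𝓘(ℝ, EG) 𝓘(ℝ, F) k 1 ξ : F)) h)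

theorem mfderiv_fundamental_of_invariant {f : M → W}
    (hf : ContMDiff 𝓘(ℝ, E) 𝓘(ℝ, F) ∞ f) (hfG : ∀ (g : G) (x : M), f (g • x) = f x)
    (ξ : GroupLieAlgebra 𝓘(ℝ, EG) G) (x : M) :
    (mfderiv 𝓘(ℝ, E) 𝓘(ℝ, F) f x (fundamental E ξ x) : F) = 0 := by
  have h : (fun g : G => f (g • x)) = fun _ => f x := funext fun g => hfG g x
  exact (mfderiv_fundamental hf ξ x).trans
    ((congrArg (fun k : G → W => (mfderiv 𝓘(ℝ, EG) 𝓘(ℝ, F) k 1 ξ : F)) h).trans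
      (DFunLike.congr_fun (mfderiv_const (I := 𝓘(ℝ, EG)) (I' := 𝓘(ℝ, F)) (c := f x) (x := (1 : G)))
        ξ))

end Actions

/-! ### Momentum maps: the kernel of the differential and of the form on a level set. -/

section MomentumMap

variable {EG : Type*} [NormedAddCommGroup EG] [NormedSpace ℝ EG]
  {G : Type*} [TopologicalSpace G] [ChartedSpace EG G] [Group G]
  {E : Type*} [NormedAddCommGroup E] [NormedSpace ℝ E]
  {M : Type*} [TopologicalSpace M] [ChartedSpace E M] [MulAction G M]

/-- The kernel of the differential of a momentum map is the orthogonal complement of the tangent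
space of the orbit. -/
theorem mfderiv_momentumMap_eq_zero_iff {σ : TwoForm E M} {J : M → (EG →L[ℝ] ℝ)}
    (hJ : IsPoissonianMomentumMap G σ J) (x : M) (v : TangentSpace 𝓘(ℝ, E) x) :
    mfderiv 𝓘(ℝ, E) 𝓘(ℝ, EG →L[ℝ] ℝ) J x v = 0 ↔
      ∀ ξ : GroupLieAlgebra 𝓘(ℝ, EG) G, σ x ![fundamental E ξ x, v] = 0 := by
  have h : ∀ ξ : EG, (show EG →L[ℝ] ℝ from mfderiv 𝓘(ℝ, E) 𝓘(ℝ, EG →L[ℝ] ℝ) J x v) ξ =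
      σ x ![fundamental E (show GroupLieAlgebra 𝓘(ℝ, EG) G from ξ) x, v] := by
    intro ξ
    have hd : HasFDerivAt (fun l : EG →L[ℝ] ℝ => l ξ) (ContinuousLinearMap.apply ℝ ℝ ξ) (J x) :=
      (ContinuousLinearMap.apply ℝ ℝ ξ).hasFDerivAt
    have hc := mfderiv_comp (I' := 𝓘(ℝ, EG →L[ℝ] ℝ)) (g := fun l : EG →L[ℝ] ℝ => l ξ) x
      hd.differentiableAt.mdifferentiableAt (hJ.smooth.mdifferentiable (by simp) x)
    rw [mfderiv_eq_fderiv, hd.fderiv] at hc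
    exact (DFunLike.congr_fun hc v).symm.trans (hJ.hamiltonian ξ x v)
  constructor
  · intro hv ξ
    exact (h ξ).symm.trans (by rw [hv]; rfl)
  · intro hv
    exact ContinuousLinearMap.ext fun ξ => (h ξ).trans (hv ξ)

/-- The kernel of the form induced on a level set of a momentum map is tangent to the orbits. -/
theorem exists_fundamental_of_mem_formKer [FiniteDimensional ℝ E] {σ : TwoForm E M}
    (hσ : IsSymplectic σ) {J : M → (EG →L[ℝ] ℝ)} (hJ : IsPoissonianMomentumMap G σ J)
    {μ : EG →L[ℝ] ℝ} {Eμ : Type*} [NormedAddCommGroup Eμ] [NormedSpace ℝ Eμ]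
    [ChartedSpace Eμ (Level J μ)] (hμ : IsWeaklyRegularValue (E := E) Eμ J μ) (y : Level J μ)
    {v : TangentSpace 𝓘(ℝ, Eμ) y} (hv : v ∈ formKer (levelForm Eμ J μ σ) y) :
    ∃ ξ : GroupLieAlgebra 𝓘(ℝ, EG) G, fundamental E ξ y.1 =
      mfderiv 𝓘(ℝ, Eμ) 𝓘(ℝ, E) (Subtype.val : Level J μ → M) y v := by
  -- `S` is the tangent space of the orbit. Vectors orthogonal to it lie in `ker dJ`, hence are
  -- tangent to the level set, and `hv` makes `v` orthogonal to those; so `v` lies in `S^⊥⊥ = S`.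
  let S : Submodule ℝ E := LinearMap.range
    (show EG →L[ℝ] E from mfderiv 𝓘(ℝ, EG) 𝓘(ℝ, E) (fun g : G => g • y.1) 1).toLinearMap
  have hnd : ∀ v : E, (∀ w : E, σ y.1 ![v, w] = 0) → v = 0 := fun v hv =>
    (Submodule.mem_bot ℝ).1 (hσ.nondegenerate y.1 ▸ (show v ∈ formKer σ y.1 from hv))
  refine mem_of_double_orthogonal (E := E) (α := σ y.1) hnd S fun u hu => ?_
  have hJu : mfderiv 𝓘(ℝ, E) 𝓘(ℝ, EG →L[ℝ] ℝ) J y.1 u = 0 :=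
    (mfderiv_momentumMap_eq_zero_iff hJ y.1 u).2 fun ξ => by
      have h := hu (fundamental E ξ y.1) ⟨ξ, rfl⟩
      exact (map_swap_twoForm (E := E) (σ y.1) u (fundamental E ξ y.1)).trans (neg_eq_zero.2 h)
  obtain ⟨u, rfl⟩ := (hμ.tangent y u).2 hJu
  have h := hv u
  refine (map_swap_twoForm (E := E) (σ y.1) _ _).trans (neg_eq_zero.2 ?_)
  exact (pullback_apply _ σ y v u).symm.trans h

end MomentumMap

/-! ### The coisotropic submanifold and the orthogonal of the orbits. -/

section Coisotropic

variable {EG : Type*} [NormedAddCommGroup EG] [NormedSpace ℝ EG]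
  {G : Type*} [TopologicalSpace G] [ChartedSpace EG G] [Group G]
  {E : Type*} [NormedAddCommGroup E] [NormedSpace ℝ E]
  {M : Type*} [TopologicalSpace M] [ChartedSpace E M] [MulAction G M]
  [ContMDiffSMul 𝓘(ℝ, EG) 𝓘(ℝ, E) ∞ G M]
  {F : Type*} [NormedAddCommGroup F] [NormedSpace ℝ F] [FiniteDimensional ℝ F]
  {W : Type*} [TopologicalSpace W] [ChartedSpace F W] [MulAction G W]

/-- If `ker Ω` is tangent to the orbits, the vectors of the ambient space that are orthogonal to
the orbits are tangent to the coisotropic submanifold. -/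
theorem exists_tangent_of_orthogonal_orbit {Ω : TwoForm E M} {σ : TwoForm F W}
    (hσ : IsSymplectic σ) {j : M → W} (hj : IsCoisotropicEmbedding j Ω σ)
    (hker : KerTangentToOrbits EG G Ω) (hext : ∀ (g : G) (x : M), j (g • x) = g • j x) (x : M)
    {w : TangentSpace 𝓘(ℝ, F) (j x)}
    (hw : ∀ ξ : GroupLieAlgebra 𝓘(ℝ, EG) G, σ (j x) ![fundamental F ξ (j x), w] = 0) :
    ∃ u : TangentSpace 𝓘(ℝ, E) x, mfderiv 𝓘(ℝ, E) 𝓘(ℝ, F) j x u = w := by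
  let S : Submodule ℝ F := LinearMap.range
    (show E →L[ℝ] F from mfderiv 𝓘(ℝ, E) 𝓘(ℝ, F) j x).toLinearMap
  have hnd : ∀ v : F, (∀ w : F, σ (j x) ![v, w] = 0) → v = 0 := fun v hv =>
    (Submodule.mem_bot ℝ).1 (hσ.nondegenerate (j x) ▸ (show v ∈ formKer σ (j x) from hv))
  refine mem_of_double_orthogonal (E := F) (α := σ (j x)) hnd S fun u hu => ?_
  -- A vector orthogonal to `S`, the image of `T_x M`, is tangent to `M` by coisotropy, then in `ker
  -- Ω`, then fundamental; `w` is orthogonal to it by `hw`.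
  obtain ⟨u, rfl⟩ := hj.coisotropic x u fun s => hu _ ⟨s, rfl⟩
  have hu' : u ∈ formKer Ω x := fun s => by
    rw [← hj.pullback_eq]
    exact (pullback_apply j σ x u s).trans (hu _ ⟨s, rfl⟩)
  obtain ⟨ξ, rfl⟩ := hker x u hu'
  have h := mfderiv_fundamental_of_equivariant hj.embedding.contMDiff hext ξ x
  exact (congrArg (fun p : F => σ (j x) ![p, w]) h).trans (hw ξ)

end Coisotropic

/-! ### The induced map of level sets. -/

section LevelMap

variable {M W V : Type*} {j : M → W} {J : W → V} {μ : V}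

theorem levelMap_injective (hj : Function.Injective j) :
    Function.Injective (levelMap j J μ) := fun _ _ h =>
  Subtype.ext (hj (congrArg Subtype.val h))

/-- The range is the trace of `range j` on the level set, since `J (j x) = μ` already puts `x` in
the level set of `J ∘ j`. -/
theorem isClosed_range_levelMap [TopologicalSpace W] (hj : IsClosed (range j)) :
    IsClosed (range (levelMap j J μ)) := by
  have : range (levelMap j J μ) = Subtype.val ⁻¹' range j := by
    ext y
    constructor
    · rintro ⟨x, rfl⟩
      exact ⟨x.1, rfl⟩
    · rintro ⟨x, hx⟩
      exact ⟨⟨x, (congrArg J hx).trans y.2⟩, Subtype.ext hx⟩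
  rw [this]
  exact hj.preimage continuous_subtype_val

end LevelMap

end PresymplecticReduction

end

/-! ### The reduction theorem. -/

open PresymplecticReduction in
theorem mainTheorem4
    -- the connected Lie group `G`
    {EG : Type*} [NormedAddCommGroup EG] [NormedSpace ℝ EG] [FiniteDimensional ℝ EG]
    {G : Type*} [TopologicalSpace G] [ChartedSpace EG G] [Group G] [LieGroup 𝓘(ℝ, EG) ∞ G]
    [T2Space G] [SecondCountableTopology G] [ConnectedSpace G]
    -- the presymplectic system `(M, Ω, H)`
    {E : Type*} [NormedAddCommGroup E] [NormedSpace ℝ E] [FiniteDimensional ℝ E]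
    {M : Type*} [TopologicalSpace M] [ChartedSpace E M] [IsManifold 𝓘(ℝ, E) ∞ M]
    [T2Space M] [SecondCountableTopology M] [ConnectedSpace M]
    (Ω : TwoForm E M) (hΩ : IsPresymplectic Ω)
    (H : M → ℝ) (hH : ContMDiff 𝓘(ℝ, E) 𝓘(ℝ, ℝ) ∞ H) (hcomp : IsCompatibleSystem Ω H)
    -- the ambient symplectic system `(W, ΩW, HW)`
    {F : Type*} [NormedAddCommGroup F] [NormedSpace ℝ F] [FiniteDimensional ℝ F]
    {W : Type*} [TopologicalSpace W] [ChartedSpace F W] [IsManifold 𝓘(ℝ, F) ∞ W]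
    [T2Space W] [SecondCountableTopology W] [ConnectedSpace W]
    (ΩW : TwoForm F W) (hΩW : IsSymplectic ΩW)
    (HW : W → ℝ) (hHW : ContMDiff 𝓘(ℝ, F) 𝓘(ℝ, ℝ) ∞ HW)
    (j : M → W) (hj : IsCoisotropicEmbedding j Ω ΩW) (hjH : ∀ x, HW (j x) = H x)
    -- the symmetry group of `(M, Ω, H)`, with `ker Ω` tangent to its orbits
    [MulAction G M] [ContMDiffSMul 𝓘(ℝ, EG) 𝓘(ℝ, E) ∞ G M]
    (hsymm : IsSymmetryGroup G Ω H) (hker : KerTangentToOrbits EG G Ω)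
    -- the extended action: symplectic, Poissonian with momentum map `J`, free and proper
    [MulAction G W] [ContMDiffSMul 𝓘(ℝ, EG) 𝓘(ℝ, F) ∞ G W]
    (hext : ∀ (g : G) (x : M), j (g • x) = g • j x)
    (hsymp : ∀ g : G, pullback F (fun y : W => g • y) ΩW = ΩW)
    (J : W → (EG →L[ℝ] ℝ)) (hJ : IsPoissonianMomentumMap G ΩW J)
    (hfree : ∀ (g : G) (y : W), g • y = y → g = 1) [ProperSMul G W]
    -- `μ` is a weakly regular value of `J ∘ j` and of `J`
    (μ : EG →L[ℝ] ℝ)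
    {Eμ : Type*} [NormedAddCommGroup Eμ] [NormedSpace ℝ Eμ] [FiniteDimensional ℝ Eμ]
    [ChartedSpace Eμ (Level (J ∘ j) μ)] [IsManifold 𝓘(ℝ, Eμ) ∞ (Level (J ∘ j) μ)]
    (hμ : IsWeaklyRegularValue (E := E) Eμ (J ∘ j) μ)
    {Fμ : Type*} [NormedAddCommGroup Fμ] [NormedSpace ℝ Fμ] [FiniteDimensional ℝ Fμ]
    [ChartedSpace Fμ (Level J μ)] [IsManifold 𝓘(ℝ, Fμ) ∞ (Level J μ)]
    (hμW : IsWeaklyRegularValue (E := F) Fμ J μ)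
    -- the two reduced spaces are quotient manifolds
    {EQ : Type*} [NormedAddCommGroup EQ] [NormedSpace ℝ EQ] [FiniteDimensional ℝ EQ]
    [ChartedSpace EQ (LeafSpace (levelForm Eμ (J ∘ j) μ Ω))]
    [IsManifold 𝓘(ℝ, EQ) ∞ (LeafSpace (levelForm Eμ (J ∘ j) μ Ω))]
    (hQ : IsQuotientManifold EQ (levelForm Eμ (J ∘ j) μ Ω))
    {FQ : Type*} [NormedAddCommGroup FQ] [NormedSpace ℝ FQ] [FiniteDimensional ℝ FQ]
    [ChartedSpace FQ (LeafSpace (levelForm Fμ J μ ΩW))]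
    [IsManifold 𝓘(ℝ, FQ) ∞ (LeafSpace (levelForm Fμ J μ ΩW))]
    (hQW : IsQuotientManifold FQ (levelForm Fμ J μ ΩW)) :
    -- 1. the level sets
    (Function.Injective (levelMap j J μ) ∧
      IsLocalDiffeomorph 𝓘(ℝ, Eμ) 𝓘(ℝ, Fμ) ∞ (levelMap j J μ) ∧
      IsUnionOfComponents (Set.range (levelMap j J μ)) ∧
      pullback Eμ (levelMap j J μ) (levelForm Fμ J μ ΩW) = levelForm Eμ (J ∘ j) μ Ω ∧
      ∀ x : Level (J ∘ j) μ, HW (levelMap j J μ x).1 = H x.1) ∧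
    -- 2a. the reduced forms and the reduced Hamiltonians are well defined
    ((∃! Ωr : TwoForm EQ (LeafSpace (levelForm Eμ (J ∘ j) μ Ω)), IsSmoothForm Ωr ∧
        pullback Eμ (leafProj (levelForm Eμ (J ∘ j) μ Ω)) Ωr = levelForm Eμ (J ∘ j) μ Ω) ∧
      (∃! Ωr : TwoForm FQ (LeafSpace (levelForm Fμ J μ ΩW)), IsSmoothForm Ωr ∧
        pullback Fμ (leafProj (levelForm Fμ J μ ΩW)) Ωr = levelForm Fμ J μ ΩW) ∧
      (∃! Hr : LeafSpace (levelForm Eμ (J ∘ j) μ Ω) → ℝ, ContMDiff 𝓘(ℝ, EQ) 𝓘(ℝ, ℝ) ∞ Hr ∧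
        ∀ x : Level (J ∘ j) μ, Hr (leafProj (levelForm Eμ (J ∘ j) μ Ω) x) = H x.1) ∧
      ((∀ (g : G) (y : W), HW (g • y) = HW y) →
        ∃! Hr : LeafSpace (levelForm Fμ J μ ΩW) → ℝ, ContMDiff 𝓘(ℝ, FQ) 𝓘(ℝ, ℝ) ∞ Hr ∧
          ∀ y : Level J μ, Hr (leafProj (levelForm Fμ J μ ΩW) y) = HW y.1)) ∧
    -- 2b. the reduced spaces
    ∃ jr : LeafSpace (levelForm Eμ (J ∘ j) μ Ω) → LeafSpace (levelForm Fμ J μ ΩW),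
      (∀ x : Level (J ∘ j) μ, jr (leafProj (levelForm Eμ (J ∘ j) μ Ω) x) =
        leafProj (levelForm Fμ J μ ΩW) (levelMap j J μ x)) ∧
      Function.Injective jr ∧
      IsLocalDiffeomorph 𝓘(ℝ, EQ) 𝓘(ℝ, FQ) ∞ jr ∧
      IsUnionOfComponents (Set.range jr) ∧
      (∀ (Ωr : TwoForm EQ (LeafSpace (levelForm Eμ (J ∘ j) μ Ω)))
          (ΩWr : TwoForm FQ (LeafSpace (levelForm Fμ J μ ΩW))),
        pullback Eμ (leafProj (levelForm Eμ (J ∘ j) μ Ω)) Ωr = levelForm Eμ (J ∘ j) μ Ω →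
        pullback Fμ (leafProj (levelForm Fμ J μ ΩW)) ΩWr = levelForm Fμ J μ ΩW →
        pullback EQ jr ΩWr = Ωr) ∧
      (∀ (Hr : LeafSpace (levelForm Eμ (J ∘ j) μ Ω) → ℝ)
          (HWr : LeafSpace (levelForm Fμ J μ ΩW) → ℝ),
        (∀ x : Level (J ∘ j) μ, Hr (leafProj (levelForm Eμ (J ∘ j) μ Ω) x) = H x.1) →
        (∀ y : Level J μ, HWr (leafProj (levelForm Fμ J μ ΩW) y) = HW y.1) →
        ∀ q, HWr (jr q) = Hr q) := by
  have hι := hμ.embedding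
  have hι' := hμW.embedding
  have hjs := hj.embedding.contMDiff
  set f := levelMap j J μ with hfdef
  have hsq : (Subtype.val : Level J μ → W) ∘ f = j ∘ (Subtype.val : Level (J ∘ j) μ → M) := rfl
  -- A continuous map into the level set is smooth once its composition with the immersion into `W`
  -- is.
  have hfs : ContMDiff 𝓘(ℝ, Eμ) 𝓘(ℝ, Fμ) ∞ f :=
    (ContMDiff.iff_comp_isImmersion hι'.isImmersion).2
      ⟨(hjs.continuous.comp continuous_subtype_val).subtype_mk _, hjs.comp hι.contMDiff⟩
  have hd := mfderiv_square hsq hfs hι'.contMDiff hι.contMDiff hjs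
  have hpb : pullback Eμ f (levelForm Fμ J μ ΩW) = levelForm Eμ (J ∘ j) μ Ω :=
    (pullback_square hsq hfs hι'.contMDiff hι.contMDiff hjs ΩW).trans
      (by rw [hj.pullback_eq]; rfl)
  have hjinj : ∀ x, Function.Injective (mfderiv 𝓘(ℝ, E) 𝓘(ℝ, F) j x) := fun x =>
    mfderiv_injective_of_isImmersionAt (hj.embedding.isImmersion.isImmersionAt x)
  have hιinj : ∀ x, Function.Injective
      (mfderiv 𝓘(ℝ, Eμ) 𝓘(ℝ, E) (Subtype.val : Level (J ∘ j) μ → M) x) := fun x =>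
    mfderiv_injective_of_isImmersionAt (hι.isImmersion.isImmersionAt x)
  have hι'inj : ∀ y, Function.Injective
      (mfderiv 𝓘(ℝ, Fμ) 𝓘(ℝ, F) (Subtype.val : Level J μ → W) y) := fun y =>
    mfderiv_injective_of_isImmersionAt (hι'.isImmersion.isImmersionAt y)
  have := FiniteDimensional.complete ℝ Eμ
  have := FiniteDimensional.complete ℝ Fμ
  have hloc : IsLocalDiffeomorph 𝓘(ℝ, Eμ) 𝓘(ℝ, Fμ) ∞ f := by
    intro x
    refine isLocalDiffeomorphAt_of_mfderiv_bijective hfs x ⟨fun v v' h => ?_, fun w => ?_⟩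
    · refine hιinj x (hjinj x.1 ?_)
      exact (hd x v).symm.trans ((congrArg (mfderiv 𝓘(ℝ, Fμ) 𝓘(ℝ, F)
        (Subtype.val : Level J μ → W) (f x)) h).trans (hd x v'))
    -- The image of `w` in `W` is orthogonal to the orbit, hence tangent to `M`; being killed by
    -- `dJ`, it is tangent to the level set of `J ∘ j`.
    · have hw := (hμW.tangent (f x) _).1 ⟨w, rfl⟩
      obtain ⟨u, hu⟩ := exists_tangent_of_orthogonal_orbit hΩW hj hker hext x.1
        ((mfderiv_momentumMap_eq_zero_iff hJ (j x.1) _).1 hw)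
      have hJu : mfderiv 𝓘(ℝ, E) 𝓘(ℝ, EG →L[ℝ] ℝ) (J ∘ j) x.1 u = 0 := by
        rw [mfderiv_comp (I' := 𝓘(ℝ, F)) x.1 (hJ.smooth.mdifferentiable (by simp) (j x.1))
          (hjs.mdifferentiable (by simp) x.1)]
        exact (congrArg (mfderiv 𝓘(ℝ, F) 𝓘(ℝ, EG →L[ℝ] ℝ) J (j x.1)) hu).trans hw
      obtain ⟨v, rfl⟩ := (hμ.tangent x u).2 hJu
      exact ⟨v, hι'inj (f x) ((hd x v).trans hu)⟩
  have hinj : Function.Injective f := levelMap_injective hj.embedding.isEmbedding.injective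
  have hcl : IsClosed (Set.range f) := isClosed_range_levelMap hj.closed_range
  have hσs : IsSmoothForm (levelForm Eμ (J ∘ j) μ Ω) := hΩ.smooth.pullback hι.contMDiff
  have hσd : IsClosedForm (levelForm Eμ (J ∘ j) μ Ω) := hΩ.closed.pullback hι.contMDiff hΩ.smooth
  have hσs' : IsSmoothForm (levelForm Fμ J μ ΩW) := hΩW.smooth.pullback hι'.contMDiff
  have hσd' : IsClosedForm (levelForm Fμ J μ ΩW) := hΩW.closed.pullback hι'.contMDiff hΩW.smooth
  obtain ⟨jr, hjr, hjrinj, hjrloc, hjrcl, hjrpb⟩ :=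
    exists_leafSpace_map hloc hinj hcl hpb hQ hQW
  refine ⟨⟨hinj, hloc, isUnionOfComponents_of_isClopen ⟨hcl, hloc.isOpen_range⟩, hpb,
    fun x => hjH x.1⟩, ⟨hQ.existsUnique_form hσs hσd, hQW.existsUnique_form hσs' hσd', ?_, ?_⟩,
    jr, hjr, hjrinj, hjrloc, isUnionOfComponents_of_isClopen hjrcl, hjrpb, ?_⟩
  · refine hQ.existsUnique_function (h := fun x => H x.1) (hH.comp hι.contMDiff) fun x v hv => ?_
    -- The double-orthogonal argument needs nondegeneracy, so `v` is pushed to `W` and recognised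
    -- there as a fundamental vector; injectivity of `dj` and equivariance bring this back to `M`,
    -- where `H` is invariant.
    obtain ⟨ξ, hξ⟩ := exists_fundamental_of_mem_formKer hΩW hJ hμW (f x)
      ((mfderiv_mem_formKer_iff hloc hpb x v).2 hv)
    have h1 : mfderiv 𝓘(ℝ, Eμ) 𝓘(ℝ, E) (Subtype.val : Level (J ∘ j) μ → M) x v =
        fundamental E ξ x.1 := hjinj x.1
      ((hd x v).symm.trans (hξ.symm.trans (mfderiv_fundamental_of_equivariant hjs hext ξ x.1).symm))
    have h2 := mfderiv_comp (I' := 𝓘(ℝ, E)) (f := (Subtype.val : Level (J ∘ j) μ → M)) x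
      (hH.mdifferentiable (by simp) x.1) (hι.contMDiff.mdifferentiable (by simp) x)
    exact (DFunLike.congr_fun h2 v).trans ((congrArg (mfderiv 𝓘(ℝ, E) 𝓘(ℝ, ℝ) H x.1) h1).trans
      (mfderiv_fundamental_of_invariant hH hsymm.function_invariant ξ x.1))
  · intro hinv
    refine hQW.existsUnique_function (h := fun y => HW y.1) (hHW.comp hι'.contMDiff)
      fun y v hv => ?_
    obtain ⟨ξ, hξ⟩ := exists_fundamental_of_mem_formKer hΩW hJ hμW y hv
    have h2 := mfderiv_comp (I' := 𝓘(ℝ, F)) (f := (Subtype.val : Level J μ → W)) y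
      (hHW.mdifferentiable (by simp) y.1) (hι'.contMDiff.mdifferentiable (by simp) y)
    exact (DFunLike.congr_fun h2 v).trans
      ((congrArg (mfderiv 𝓘(ℝ, F) 𝓘(ℝ, ℝ) HW y.1) hξ.symm).trans
        (mfderiv_fundamental_of_invariant hHW hinv ξ y.1))
  · intro Hr HWr hHr hHWr q
    obtain ⟨x, rfl⟩ := surjective_leafProj _ q
    rw [hjr, hHWr, hHr]
    exact hjH x.1
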